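/- Let $k$ be a field of characteristic $\ne 2$ and let $\mathcal{H}=\mathcal{H}_0\oplus\mathcal{H}_1$ be a Hopf superalgebra over $k$, i.e. a $\mathbb{Z}/2$-graded associative unital $k$-algebra with a coassociative, counital comultiplication $\Delta_{\mathcal H}$, with counit $\varepsilon$ and antipode $S_{\mathcal H}$ satisfying the usual axioms, all three maps being even, with $\varepsilon$ an algebra map, $\Delta_{\mathcal H}(1)=1\otimes 1$ and $$\Delta_{\mathcal H}(ab)=\sum(-1)^{|a_2||b_1|}a_1b_1\otimes a_2b_2 .$$ Let $\mathrm{Corep}(\mathcal{H})$ be the category of finite-dimensional $\mathcal{H}$-comodules in supervector spaces: its objects are finite-dimensional $\mathbb{Z}/2$-graded vector spaces $V$ with an even (right) coaction $V\to V\otimes\mathcal{H}$, its morphisms are the even comodule maps, and its tensor product is $V\otimes W$ with the coaction $v\otimes w\mapsto\sum(-1)^{|v_1||w_0|}(v_0\otimes w_0)\otimes v_1w_1$. Let $\mathcal{H}'$ be the algebra $k[\mathbb{Z}/2]\ltimes\mathcal{H}$, where the generator $g$ of $\mathbb{Z}/2$ satisfies $g^2=1$ and $gh=(-1)^{|h|}hg$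 for homogeneous $h\in\mathcal{H}$, graded by $|hg^e|=|h|$. Let $\widetilde\Delta(hg^e)=\Delta_{\mathcal H}(h)(g^e\otimes g^e)$ and $\widetilde S(hg^e)=g^eS_{\mathcal H}(h)$ be the comultiplication and antipode of the semidirect product Hopf superalgebra, and write $\widetilde\Delta=\widetilde\Delta_0+\widetilde\Delta_1$, where $\widetilde\Delta_i$ takes values in the tensors whose second factor has degree $i$. Then $\mathcal{H}'$ is an ordinary Hopf algebra with counit $hg^e\mapsto\varepsilon(h)$, and with comultiplication and antipode given for homogeneous $x\in\mathcal{H}'$ by $$\Delta(x)=\widetilde\Delta_0(x)-(-1)^{|x|}(g\otimes 1)\widetilde\Delta_1(x),\qquad S(x)=g^{|x|}\widetilde S(x).$$ Let $\mathrm{Corep}(\mathcal{H}')$ be the tensor category of finite-dimensional (right) $\mathcal{H}'$-comodules in vector spaces. Then $\mathrm{Corep}(\mathcal{H})$ and $\mathrm{Corep}(\mathcal{H}')$ are equivalent as $k$-linear tensor categories: there is a $k$-linear strong monoidal functor $\mathrm{Corep}(\mathcal{H})\to\mathrm{Corep}(\mathcal{H}')$ which is an equivalence of categories. -/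

import Mathlib

open CategoryTheory
open scoped TensorProduct

universe u v

set_option linter.unusedSectionVars false
set_option linter.unusedVariables false

namespace SuperHopf

/-! ### Super vector spaces: vector spaces graded by `ZMod 2` -/

section SuperLinearAlgebra

variable {k : Type u} [Field k]
variable {V : Type*} [AddCommGroup V] [Module k V] (𝒱 : ZMod 2 → Submodule k V)
variable {W : Type*} [AddCommGroup W] [Module k W] (𝒲 : ZMod 2 → Submodule k W)
variable {X : Type*} [AddCommGroup X] [Module k X] (𝒳 : ZMod 2 → Submodule k X)
variable {M : Type*} [AddCommGroup M] [Module k M]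

/-- The sign `(-1)^n` attached to a class `n` modulo `2`. -/
def sgn (k : Type u) [Field k] (n : ZMod 2) : k := (-1) ^ n.val

/-- The projection of a super vector space onto its component of degree `i`. -/
def proj [DirectSum.Decomposition 𝒱] (i : ZMod 2) : V →ₗ[k] V :=
  (𝒱 i).subtype ∘ₗ DirectSum.component k (ZMod 2) (fun j => 𝒱 j) i ∘ₗ
    (DirectSum.decomposeLinearEquiv 𝒱).toLinearMap

/-- The parity automorphism `v ↦ (-1)^|v| v`. -/
def parity [DirectSum.Decomposition 𝒱] : V →ₗ[k] V := proj 𝒱 0 - proj 𝒱 1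

/-- The grading of `V ⊗ W`: degree `n` is spanned by the `v ⊗ w` with `|v| + |w| = n`. -/
def tensorGrading (n : ZMod 2) : Submodule k (V ⊗[k] W) :=
  ⨆ (i : ZMod 2) (j : ZMod 2) (_ : i + j = n),
    Submodule.map₂ (TensorProduct.mk k V W) (𝒱 i) (𝒲 j)

/-- The super symmetry `V ⊗ W → W ⊗ V`, `v ⊗ w ↦ (-1)^(|v||w|) w ⊗ v`. -/
def superBraid [DirectSum.Decomposition 𝒱] [DirectSum.Decomposition 𝒲] :
    V ⊗[k] W →ₗ[k] W ⊗[k] V :=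
  ∑ i : ZMod 2, ∑ j : ZMod 2, sgn k (i * j) •
    ((TensorProduct.comm k V W).toLinearMap ∘ₗ TensorProduct.map (proj 𝒱 i) (proj 𝒲 j))

lemma sum_zmod2 {N : Type*} [AddCommMonoid N] (f : ZMod 2 → N) : ∑ i, f i = f 0 + f 1 :=
  Fin.sum_univ_two f

lemma zmod2_cases (i : ZMod 2) : i = 0 ∨ i = 1 := by
  revert i; decide

lemma sgn_zero : sgn k 0 = 1 := by simp [sgn]

lemma sgn_one : sgn k 1 = -1 := by simp [sgn, ZMod.val_one]

lemma sgn_add (i j : ZMod 2) : sgn k (i + j) = sgn k i * sgn k j := by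
  have h2 : (1 : ZMod 2) + 1 = 0 := by decide
  rcases zmod2_cases i with rfl | rfl <;> rcases zmod2_cases j with rfl | rfl <;>
    simp [sgn_zero, sgn_one, h2]

lemma sgn_mul_self (i : ZMod 2) : sgn k i * sgn k i = 1 := by
  rcases zmod2_cases i with rfl | rfl <;> simp [sgn_zero, sgn_one]

section Proj

variable [DirectSum.Decomposition 𝒱] [DirectSum.Decomposition 𝒲] [DirectSum.Decomposition 𝒳]

lemma proj_apply (i : ZMod 2) (x : V) : proj 𝒱 i x = (DirectSum.decompose 𝒱 x i : V) := rfl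

lemma proj_mem (i : ZMod 2) (x : V) : proj 𝒱 i x ∈ 𝒱 i := by
  rw [proj_apply]; exact SetLike.coe_mem _

variable {𝒱 𝒲}

lemma proj_same {i : ZMod 2} {x : V} (h : x ∈ 𝒱 i) : proj 𝒱 i x = x := by
  rw [proj_apply, DirectSum.decompose_of_mem_same 𝒱 h]

lemma proj_ne {i j : ZMod 2} {x : V} (h : x ∈ 𝒱 i) (hij : i ≠ j) : proj 𝒱 j x = 0 := by
  rw [proj_apply, DirectSum.decompose_of_mem_ne 𝒱 h hij]

lemma proj_eq {i j : ZMod 2} {x : V} (h : x ∈ 𝒱 i) :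
    proj 𝒱 j x = if i = j then x else 0 := by
  split_ifs with hij
  · subst hij; exact proj_same h
  · exact proj_ne h hij

lemma parity_eq {i : ZMod 2} {x : V} (h : x ∈ 𝒱 i) : parity 𝒱 x = sgn k i • x := by
  rcases zmod2_cases i with rfl | rfl <;>
    simp [parity, proj_eq h, sgn_zero, sgn_one]

lemma superBraid_eq {i j : ZMod 2} {x : V} {y : W} (hx : x ∈ 𝒱 i) (hy : y ∈ 𝒲 j) :
    superBraid 𝒱 𝒲 (x ⊗ₜ y) = sgn k (i * j) • (y ⊗ₜ[k] x) := by
  rcases zmod2_cases i with rfl | rfl <;> rcases zmod2_cases j with rfl | rfl <;>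
    simp [superBraid, proj_eq hx, proj_eq hy, sum_zmod2, -Fin.sum_univ_two]

variable (𝒱 𝒲)

lemma proj_add (x : V) : proj 𝒱 0 x + proj 𝒱 1 x = x := by
  refine DirectSum.Decomposition.inductionOn 𝒱 (motive := fun x => proj 𝒱 0 x + proj 𝒱 1 x = x)
    (by simp) ?_ ?_ x
  · rintro i ⟨y, hy⟩
    rcases zmod2_cases i with rfl | rfl <;> simp [proj_eq hy]
  · intro a b ha hb
    rw [map_add, map_add, add_add_add_comm, ha, hb]

lemma hom_ext' {f g : V →ₗ[k] M} (h : ∀ i, ∀ x ∈ 𝒱 i, f x = g x) : f = g := by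
  ext x
  rw [← proj_add 𝒱 x, map_add, map_add, h 0 _ (proj_mem 𝒱 0 x), h 1 _ (proj_mem 𝒱 1 x)]

lemma parity_parity (x : V) : parity 𝒱 (parity 𝒱 x) = x := by
  have : parity 𝒱 ∘ₗ parity 𝒱 = LinearMap.id := hom_ext' 𝒱 fun i x hx => by
    simp [parity_eq hx, smul_smul, sgn_mul_self]
  exact LinearMap.congr_fun this x

variable {𝒱 𝒲}

/-- Even maps commute with the projections. -/
lemma proj_map {f : V →ₗ[k] W} (hf : ∀ i, ∀ x ∈ 𝒱 i, f x ∈ 𝒲 i) (i : ZMod 2) (x : V) :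
    proj 𝒲 i (f x) = f (proj 𝒱 i x) := by
  have : proj 𝒲 i ∘ₗ f = f ∘ₗ proj 𝒱 i := hom_ext' 𝒱 fun j x hx => by
    simp only [LinearMap.comp_apply, proj_eq hx, proj_eq (hf j x hx)]
    split_ifs <;> simp
  exact LinearMap.congr_fun this x

lemma symm_mem (e : V ≃ₗ[k] W) (hf : ∀ i, ∀ x ∈ 𝒱 i, e x ∈ 𝒲 i) (i : ZMod 2) (y : W)
    (hy : y ∈ 𝒲 i) : e.symm y ∈ 𝒱 i := by
  have h := proj_map (f := e.toLinearMap) hf i (e.symm y)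
  simp only [LinearEquiv.coe_coe, LinearEquiv.apply_symm_apply] at h
  rw [proj_same hy] at h
  rw [h, LinearEquiv.symm_apply_apply]
  exact proj_mem 𝒱 i _

end Proj

section Tensor

variable {𝒱 𝒲}

lemma tmul_mem {i j n : ZMod 2} (h : i + j = n) {x : V} {y : W} (hx : x ∈ 𝒱 i) (hy : y ∈ 𝒲 j) :
    x ⊗ₜ[k] y ∈ tensorGrading 𝒱 𝒲 n := by
  refine Submodule.mem_iSup_of_mem i (Submodule.mem_iSup_of_mem j
    (Submodule.mem_iSup_of_mem h ?_))
  exact Submodule.apply_mem_map₂ (TensorProduct.mk k V W) hx hy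

lemma tensorGrading_le {n : ZMod 2} {P : Submodule k (V ⊗[k] W)}
    (h : ∀ i j, i + j = n → ∀ x ∈ 𝒱 i, ∀ y ∈ 𝒲 j, x ⊗ₜ[k] y ∈ P) :
    tensorGrading 𝒱 𝒲 n ≤ P := by
  refine iSup_le fun i => iSup_le fun j => iSup_le fun hij => ?_
  rw [Submodule.map₂_le]
  exact fun x hx y hy => h i j hij x hx y hy

/-- Even maps out of a tensor product can be recognized on homogeneous pure tensors. -/
lemma map_tensor_mem {n : ZMod 2} {f : V ⊗[k] W →ₗ[k] M} {Q : Submodule k M}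
    (h : ∀ i j, i + j = n → ∀ x ∈ 𝒱 i, ∀ y ∈ 𝒲 j, f (x ⊗ₜ[k] y) ∈ Q)
    {t : V ⊗[k] W} (ht : t ∈ tensorGrading 𝒱 𝒲 n) : f t ∈ Q :=
  tensorGrading_le (P := Q.comap f) (fun i j hij x hx y hy => h i j hij x hx y hy) ht

lemma eqOn_tensor {n : ZMod 2} {f g : V ⊗[k] W →ₗ[k] M}
    (h : ∀ i j, i + j = n → ∀ x ∈ 𝒱 i, ∀ y ∈ 𝒲 j, f (x ⊗ₜ[k] y) = g (x ⊗ₜ[k] y))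
    {t : V ⊗[k] W} (ht : t ∈ tensorGrading 𝒱 𝒲 n) : f t = g t :=
  tensorGrading_le (P := LinearMap.eqLocus f g)
    (fun i j hij x hx y hy => h i j hij x hx y hy) ht

variable (𝒱 𝒲) [DirectSum.Decomposition 𝒱] [DirectSum.Decomposition 𝒲]

lemma tensor_ext {f g : V ⊗[k] W →ₗ[k] M}
    (h : ∀ i j, ∀ x ∈ 𝒱 i, ∀ y ∈ 𝒲 j, f (x ⊗ₜ[k] y) = g (x ⊗ₜ[k] y)) : f = g := by
  apply TensorProduct.ext
  refine hom_ext' 𝒱 fun i x hx => hom_ext' 𝒲 fun j y hy => ?_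
  exact h i j x hx y hy

/-- A family of projectors onto the `𝒱 i` gives a decomposition. -/
abbrev decompositionOfProj (𝒱 : ZMod 2 → Submodule k V) (Q : ZMod 2 → V →ₗ[k] V)
    (hmem : ∀ i x, Q i x ∈ 𝒱 i) (hQ : ∀ i j, ∀ x ∈ 𝒱 i, Q j x = if i = j then x else 0)
    (hsum : ∀ x, Q 0 x + Q 1 x = x) : DirectSum.Decomposition 𝒱 :=
  DirectSum.Decomposition.ofLinearMap 𝒱
    (∑ i, DirectSum.lof k (ZMod 2) (fun i => 𝒱 i) i ∘ₗ (Q i).codRestrict (𝒱 i) (hmem i))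
    (by
      ext x
      rw [sum_zmod2]
      simp [hsum])
    (by
      ext i x : 2
      rw [sum_zmod2]
      have h0 : (Q 0).codRestrict (𝒱 0) (hmem 0) (x : V) = if h : i = 0 then h ▸ x else 0 := by
        ext
        rcases zmod2_cases i with rfl | rfl <;> simp [hQ _ _ _ x.2]
      have h1 : (Q 1).codRestrict (𝒱 1) (hmem 1) (x : V) = if h : i = 1 then h ▸ x else 0 := by
        ext
        rcases zmod2_cases i with rfl | rfl <;> simp [hQ _ _ _ x.2]
      simp only [LinearMap.comp_apply, LinearMap.add_apply, DirectSum.coeLinearMap_lof, h0, h1,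
        LinearMap.id_apply]
      rcases zmod2_cases i with rfl | rfl <;> simp)

/-- `V ⊗ W` is again a super vector space. -/
instance tensorDecomposition : DirectSum.Decomposition (tensorGrading 𝒱 𝒲) :=
  decompositionOfProj (tensorGrading 𝒱 𝒲)
    (fun n => ∑ i : ZMod 2, TensorProduct.map (proj 𝒱 i) (proj 𝒲 (n - i)))
    (fun n t => by
      rw [LinearMap.sum_apply]
      refine Submodule.sum_mem _ fun i _ => ?_
      induction t using TensorProduct.induction_on with
      | zero => simp
      | tmul x y => exact tmul_mem (by ring) (proj_mem 𝒱 i x) (proj_mem 𝒲 _ y)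
      | add a b ha hb => rw [map_add]; exact Submodule.add_mem _ ha hb)
    (fun n m t ht => by
      have h2 : (1 : ZMod 2) + 1 = 0 := by decide
      have h3 : (0 : ZMod 2) - 1 = 1 := by decide
      have key : (∑ i : ZMod 2, TensorProduct.map (proj 𝒱 i) (proj 𝒲 (m - i))) t =
          ((if n = m then (1 : k) else 0) • (LinearMap.id : V ⊗[k] W →ₗ[k] V ⊗[k] W)) t := by
        refine eqOn_tensor (fun i j hij x hx y hy => ?_) ht
        subst hij
        rw [sum_zmod2]
        rcases zmod2_cases i with rfl | rfl <;> rcases zmod2_cases j with rfl | rfl <;>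
          rcases zmod2_cases m with rfl | rfl <;>
          simp [proj_eq hx, proj_eq hy, h2, h3]
      rw [key]
      split_ifs <;> simp)
    (fun t => by
      have h3 : (0 : ZMod 2) - 1 = 1 := by decide
      rw [sum_zmod2, sum_zmod2, ← LinearMap.add_apply]
      have : ∀ f : V ⊗[k] W →ₗ[k] V ⊗[k] W, f = LinearMap.id → f t = t := by
        rintro f rfl; rfl
      apply this
      refine tensor_ext 𝒱 𝒲 fun i j x hx y hy => ?_
      rcases zmod2_cases i with rfl | rfl <;> rcases zmod2_cases j with rfl | rfl <;>
        simp [proj_eq hx, proj_eq hy, h3])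

end Tensor

/-- The base field as a purely even super vector space. -/
def unitGrading (k : Type u) [Field k] (i : ZMod 2) : Submodule k k := if i = 0 then ⊤ else ⊥

instance unitDecomposition (k : Type u) [Field k] : DirectSum.Decomposition (unitGrading k) :=
  decompositionOfProj (unitGrading k) (fun i => if i = 0 then LinearMap.id else 0)
    (fun i x => by rcases zmod2_cases i with rfl | rfl <;> simp [unitGrading])
    (fun i j x hx => by
      rcases zmod2_cases i with rfl | rfl <;> rcases zmod2_cases j with rfl | rfl <;>
        simp_all [unitGrading])
    (fun x => by simp)

end SuperLinearAlgebra

/-! ### Hopf superalgebras -/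

/-- A Hopf superalgebra: a Hopf algebra in super vector spaces.  The `ZMod 2`-graded algebra `H`
carries a coassociative counital coalgebra structure; comultiplication, counit and antipode are
even, the counit is multiplicative, and the comultiplication is multiplicative in the super sense,
i.e. for the product `(a ⊗ b)(c ⊗ d) = (-1)^(|b||c|) ac ⊗ bd` of the graded tensor product. -/
class HopfSuperalgebra {k : Type u} {H : Type v} [Field k] [Ring H] [Algebra k H] [Coalgebra k H]
    (𝒜 : ZMod 2 → Submodule k H) [GradedAlgebra 𝒜] where
  comul_mem : ∀ i, ∀ a ∈ 𝒜 i, Coalgebra.comul (R := k) a ∈ tensorGrading 𝒜 𝒜 i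
  counit_mem : ∀ i, ∀ a ∈ 𝒜 i, Coalgebra.counit (R := k) a ∈ unitGrading k i
  comul_one : Coalgebra.comul (R := k) (1 : H) = 1 ⊗ₜ[k] 1
  comul_mul : ∀ a b : H, GradedTensorProduct.of k 𝒜 𝒜 (Coalgebra.comul (R := k) (a * b)) =
    GradedTensorProduct.of k 𝒜 𝒜 (Coalgebra.comul (R := k) a) *
      GradedTensorProduct.of k 𝒜 𝒜 (Coalgebra.comul (R := k) b)
  counit_one : Coalgebra.counit (R := k) (1 : H) = 1
  counit_mul : ∀ a b : H, Coalgebra.counit (R := k) (a * b) =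
    Coalgebra.counit (R := k) a * Coalgebra.counit (R := k) b
  /-- The antipode. -/
  antipode : H →ₗ[k] H
  antipode_mem : ∀ i, ∀ a ∈ 𝒜 i, antipode a ∈ 𝒜 i
  mul_antipode_rTensor_comul : LinearMap.mul' k H ∘ₗ antipode.rTensor H ∘ₗ Coalgebra.comul =
    Algebra.linearMap k H ∘ₗ Coalgebra.counit
  mul_antipode_lTensor_comul : LinearMap.mul' k H ∘ₗ antipode.lTensor H ∘ₗ Coalgebra.comul =
    Algebra.linearMap k H ∘ₗ Coalgebra.counit

section HopfSuperalgebra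

variable {k : Type u} {H : Type v} [Field k] [Ring H] [Algebra k H]
variable (𝒜 : ZMod 2 → Submodule k H) [GradedAlgebra 𝒜]

/-- The multiplication of the graded tensor product `H ⊗ H`, as a linear map. -/
noncomputable def superMul : (H ⊗[k] H) ⊗[k] (H ⊗[k] H) →ₗ[k] H ⊗[k] H :=
  TensorProduct.lift ((GradedTensorProduct.mulHom 𝒜 𝒜).compl₁₂
    (GradedTensorProduct.of k 𝒜 𝒜).toLinearMap (GradedTensorProduct.of k 𝒜 𝒜).toLinearMap |>.compr₂
    (GradedTensorProduct.of k 𝒜 𝒜).symm.toLinearMap)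

lemma superMul_tmul (s t : H ⊗[k] H) : superMul 𝒜 (s ⊗ₜ t) =
    (GradedTensorProduct.of k 𝒜 𝒜).symm
      (GradedTensorProduct.of k 𝒜 𝒜 s * GradedTensorProduct.of k 𝒜 𝒜 t) := rfl

lemma uzpow_smul {M : Type*} [AddCommGroup M] [Module k M] (n : ZMod 2) (x : M) :
    ((-1 : ℤˣ) ^ n) • x = sgn k n • x := by
  rcases zmod2_cases n with rfl | rfl <;> simp [sgn_zero, sgn_one]

variable {𝒜}

lemma superMul_hom {i j : ZMod 2} (a : H) {b c : H} (d : H) (hb : b ∈ 𝒜 i) (hc : c ∈ 𝒜 j) :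
    superMul 𝒜 ((a ⊗ₜ b) ⊗ₜ (c ⊗ₜ d)) = sgn k (i * j) • ((a * c) ⊗ₜ[k] (b * d)) := by
  rw [superMul_tmul]
  have := GradedTensorProduct.tmul_coe_mul_coe_tmul (R := k) 𝒜 𝒜 a (⟨b, hb⟩ : 𝒜 i)
    (⟨c, hc⟩ : 𝒜 j) d
  simp only at this
  erw [this]
  rw [uzpow_smul (k := k), map_smul]
  rfl

variable (𝒜)

lemma parity_mul (a b : H) : parity 𝒜 (a * b) = parity 𝒜 a * parity 𝒜 b := by
  have : parity 𝒜 ∘ₗ LinearMap.mul' k H =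
      LinearMap.mul' k H ∘ₗ TensorProduct.map (parity 𝒜) (parity 𝒜) := by
    refine tensor_ext 𝒜 𝒜 fun i j x hx y hy => ?_
    have hxy : x * y ∈ 𝒜 (i + j) := SetLike.mul_mem_graded hx hy
    simp only [LinearMap.comp_apply, LinearMap.mul'_apply, TensorProduct.map_tmul, parity_eq hx,
      parity_eq hy, parity_eq hxy, sgn_add, smul_mul_smul_comm]
  exact LinearMap.congr_fun this (a ⊗ₜ b)

lemma parity_one : parity 𝒜 (1 : H) = 1 := by
  rw [parity_eq (SetLike.one_mem_graded 𝒜), sgn_zero, one_smul]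

variable [Coalgebra k H] [HopfSuperalgebra 𝒜]

lemma comul_mul' (a b : H) : Coalgebra.comul (R := k) (a * b) =
    superMul 𝒜 (Coalgebra.comul (R := k) a ⊗ₜ Coalgebra.comul (R := k) b) := by
  rw [superMul_tmul, ← HopfSuperalgebra.comul_mul]; rfl

variable {𝒜}

lemma counit_eq {i : ZMod 2} {a : H} (ha : a ∈ 𝒜 i) (h : i ≠ 0) :
    Coalgebra.counit (R := k) a = 0 := by
  have := HopfSuperalgebra.counit_mem i a ha
  simpa [unitGrading, h] using this

lemma sgn_smul_counit {i : ZMod 2} {a : H} (ha : a ∈ 𝒜 i) (j : ZMod 2) :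
    sgn k (i * j) * Coalgebra.counit (R := k) a = Coalgebra.counit (R := k) a := by
  by_cases h : i = 0
  · simp [h, sgn_zero]
  · simp [counit_eq ha h]

end HopfSuperalgebra

/-! ### The tensor product coaction -/

section TensorCoaction

variable {k : Type u} [Field k]
variable {V W V' W' : Type*} [AddCommGroup V] [Module k V] [AddCommGroup W] [Module k W]
variable {A B : Type*} [AddCommGroup A] [Module k A] [AddCommGroup B] [Module k B]

/-- `v ⊗ a ⊗ w ⊗ b ↦ v ⊗ β(a ⊗ w) ⊗ b`, regrouped. -/
def midSwap (β : A ⊗[k] W →ₗ[k] W ⊗[k] A) :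
    (V ⊗[k] A) ⊗[k] (W ⊗[k] B) →ₗ[k] (V ⊗[k] W) ⊗[k] (A ⊗[k] B) :=
  (TensorProduct.assoc k V W (A ⊗[k] B)).symm.toLinearMap ∘ₗ
    LinearMap.lTensor V ((TensorProduct.assoc k W A B).toLinearMap ∘ₗ LinearMap.rTensor B β ∘ₗ
      (TensorProduct.assoc k A W B).symm.toLinearMap) ∘ₗ
    (TensorProduct.assoc k V A (W ⊗[k] B)).toLinearMap

lemma midSwap_tmul {β : A ⊗[k] W →ₗ[k] W ⊗[k] A} {a : A} {w : W} {c : k}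
    (h : β (a ⊗ₜ w) = c • (w ⊗ₜ a)) (v : V) (b : B) :
    midSwap β ((v ⊗ₜ a) ⊗ₜ (w ⊗ₜ b)) = c • ((v ⊗ₜ[k] w) ⊗ₜ[k] (a ⊗ₜ[k] b)) := by
  simp [midSwap, h, TensorProduct.smul_tmul']

end TensorCoaction

section SuperTensor

variable {k : Type u} {H : Type v} [Field k] [Ring H] [Algebra k H]
variable (𝒜 : ZMod 2 → Submodule k H) [GradedAlgebra 𝒜]
variable {V : Type*} [AddCommGroup V] [Module k V] (𝒱 : ZMod 2 → Submodule k V)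
variable {W : Type*} [AddCommGroup W] [Module k W] (𝒲 : ZMod 2 → Submodule k W)
variable [DirectSum.Decomposition 𝒲]

lemma star_ext {N : Type*} [AddCommGroup N] [Module k N]
    {f g : (V ⊗[k] H) ⊗[k] (W ⊗[k] H) →ₗ[k] N}
    (h : ∀ v i, ∀ a ∈ 𝒜 i, ∀ j, ∀ w ∈ 𝒲 j, ∀ b,
      f ((v ⊗ₜ a) ⊗ₜ (w ⊗ₜ b)) = g ((v ⊗ₜ a) ⊗ₜ (w ⊗ₜ b))) : f = g := by
  apply TensorProduct.ext
  apply TensorProduct.ext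
  refine LinearMap.ext fun v => hom_ext' 𝒜 fun i a ha => ?_
  apply TensorProduct.ext
  refine hom_ext' 𝒲 fun j w hw => LinearMap.ext fun b => ?_
  exact h v i a ha j w hw b

/-- `(v ⊗ a) ⊗ (w ⊗ b) ↦ (-1)^(|a||w|) (v ⊗ w) ⊗ ab`. -/
def superStar : (V ⊗[k] H) ⊗[k] (W ⊗[k] H) →ₗ[k] (V ⊗[k] W) ⊗[k] H :=
  LinearMap.lTensor (V ⊗[k] W) (LinearMap.mul' k H) ∘ₗ midSwap (superBraid 𝒜 𝒲)

/-- The tensor product of two coactions on super vector spaces: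
`v ⊗ w ↦ (-1)^(|v₁||w₀|) (v₀ ⊗ w₀) ⊗ v₁w₁`. -/
def superTensorCoact (ρV : V →ₗ[k] V ⊗[k] H) (ρW : W →ₗ[k] W ⊗[k] H) :
    V ⊗[k] W →ₗ[k] (V ⊗[k] W) ⊗[k] H :=
  superStar 𝒜 𝒲 ∘ₗ TensorProduct.map ρV ρW

variable {𝒜 𝒱 𝒲}

lemma superStar_hom {i j : ZMod 2} (v : V) {a : H} {w : W} (b : H) (ha : a ∈ 𝒜 i) (hw : w ∈ 𝒲 j) :
    superStar 𝒜 𝒲 ((v ⊗ₜ a) ⊗ₜ (w ⊗ₜ b)) = sgn k (i * j) • ((v ⊗ₜ[k] w) ⊗ₜ[k] (a * b)) := by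
  simp [superStar, midSwap_tmul (superBraid_eq ha hw)]

lemma superStar_mem {i j n : ZMod 2} (hn : i + j = n) {x : V ⊗[k] H} {y : W ⊗[k] H}
    (hx : x ∈ tensorGrading 𝒱 𝒜 i) (hy : y ∈ tensorGrading 𝒲 𝒜 j) :
    superStar 𝒜 𝒲 (x ⊗ₜ y) ∈ tensorGrading (tensorGrading 𝒱 𝒲) 𝒜 n := by
  refine map_tensor_mem (f := superStar 𝒜 𝒲 ∘ₗ (TensorProduct.mk k _ _).flip y) ?_ hx
  intro a b hab v hv h hh
  refine map_tensor_mem (f := superStar 𝒜 𝒲 ∘ₗ (TensorProduct.mk k _ _) (v ⊗ₜ h)) ?_ hy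
  intro c d hcd w hw h' hh'
  simp only [LinearMap.comp_apply, TensorProduct.mk_apply, superStar_hom v h' hh hw]
  refine Submodule.smul_mem _ _ (tmul_mem (i := a + c) (j := b + d) ?_ (tmul_mem rfl hv hw)
    (SetLike.mul_mem_graded hh hh'))
  subst hn hab hcd; ring

lemma superTensorCoact_mem {ρV : V →ₗ[k] V ⊗[k] H} {ρW : W →ₗ[k] W ⊗[k] H}
    (hV : ∀ i, ∀ v ∈ 𝒱 i, ρV v ∈ tensorGrading 𝒱 𝒜 i)
    (hW : ∀ i, ∀ v ∈ 𝒲 i, ρW v ∈ tensorGrading 𝒲 𝒜 i) (n : ZMod 2) (t : V ⊗[k] W)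
    (ht : t ∈ tensorGrading 𝒱 𝒲 n) :
    superTensorCoact 𝒜 𝒲 ρV ρW t ∈ tensorGrading (tensorGrading 𝒱 𝒲) 𝒜 n := by
  refine map_tensor_mem ?_ ht
  intro i j hij v hv w hw
  exact superStar_mem hij (hV i v hv) (hW j w hw)

variable (𝒜 𝒱 𝒲)

/-- Auxiliary: the analogue of `superStar` for coefficients in the graded tensor product. -/
noncomputable def superStar₂ : (V ⊗[k] (H ⊗[k] H)) ⊗[k] (W ⊗[k] (H ⊗[k] H)) →ₗ[k]
    (V ⊗[k] W) ⊗[k] (H ⊗[k] H) :=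
  LinearMap.lTensor (V ⊗[k] W) (superMul 𝒜) ∘ₗ midSwap (superBraid (tensorGrading 𝒜 𝒜) 𝒲)

variable {𝒜 𝒱 𝒲}

lemma superStar₂_hom {i j : ZMod 2} (v : V) {s : H ⊗[k] H} {w : W} (t : H ⊗[k] H)
    (hs : s ∈ tensorGrading 𝒜 𝒜 i) (hw : w ∈ 𝒲 j) :
    superStar₂ 𝒜 𝒲 ((v ⊗ₜ s) ⊗ₜ (w ⊗ₜ t)) =
      sgn k (i * j) • ((v ⊗ₜ[k] w) ⊗ₜ[k] superMul 𝒜 (s ⊗ₜ t)) := by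
  simp [superStar₂, midSwap_tmul (superBraid_eq hs hw)]

lemma superStar_assoc {a b : ZMod 2} (x : V ⊗[k] H) {h : H} {y : W ⊗[k] H} (h' : H)
    (hh : h ∈ 𝒜 a) (hy : y ∈ tensorGrading 𝒲 𝒜 b) :
    superStar₂ 𝒜 𝒲 (TensorProduct.assoc k V H H (x ⊗ₜ h) ⊗ₜ
      TensorProduct.assoc k W H H (y ⊗ₜ h')) =
    sgn k (a * b) • TensorProduct.assoc k (V ⊗[k] W) H H
      (superStar 𝒜 𝒲 (x ⊗ₜ y) ⊗ₜ (h * h')) := by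
  induction x using TensorProduct.induction_on with
  | zero => simp
  | add x₁ x₂ h₁ h₂ => simp only [TensorProduct.add_tmul, map_add, h₁, h₂, smul_add]
  | tmul v c =>
    rw [← proj_add 𝒜 c]
    simp only [TensorProduct.add_tmul, TensorProduct.tmul_add, map_add, smul_add]
    have key : ∀ n, ∀ c ∈ 𝒜 n, superStar₂ 𝒜 𝒲 (TensorProduct.assoc k V H H ((v ⊗ₜ c) ⊗ₜ h) ⊗ₜ
      TensorProduct.assoc k W H H (y ⊗ₜ h')) =
        sgn k (a * b) • TensorProduct.assoc k (V ⊗[k] W) H H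
          (superStar 𝒜 𝒲 ((v ⊗ₜ c) ⊗ₜ y) ⊗ₜ (h * h')) := by
      intro n c hc
      refine eqOn_tensor (f := superStar₂ 𝒜 𝒲 ∘ₗ TensorProduct.mk k _ _
          (TensorProduct.assoc k V H H ((v ⊗ₜ c) ⊗ₜ h)) ∘ₗ
          (TensorProduct.assoc k W H H).toLinearMap ∘ₗ (TensorProduct.mk k _ _).flip h')
        (g := sgn k (a * b) • (TensorProduct.assoc k (V ⊗[k] W) H H).toLinearMap ∘ₗ
          (TensorProduct.mk k _ _).flip (h * h') ∘ₗ superStar 𝒜 𝒲 ∘ₗ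
            TensorProduct.mk k _ _ (v ⊗ₜ c)) ?_ hy
      intro i j hij w hw d hd
      simp only [LinearMap.comp_apply, TensorProduct.mk_apply, LinearMap.flip_apply,
        LinearEquiv.coe_coe, TensorProduct.assoc_tmul, LinearMap.smul_apply,
        superStar_hom v d hc hw, superStar₂_hom v _ (tmul_mem rfl hc hh) hw,
        superMul_hom c h' hh hd, TensorProduct.tmul_smul, map_smul, smul_smul]
      congr 1
      rw [← sgn_add, ← sgn_add]
      congr 1
      subst hij; ring
    rw [key 0 _ (proj_mem 𝒜 0 c), key 1 _ (proj_mem 𝒜 1 c)]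

variable [Coalgebra k H] [HopfSuperalgebra 𝒜]

lemma superStar_comul (z : (V ⊗[k] H) ⊗[k] (W ⊗[k] H)) :
    LinearMap.lTensor (V ⊗[k] W) Coalgebra.comul (superStar 𝒜 𝒲 z) =
    superStar₂ 𝒜 𝒲 (TensorProduct.map (LinearMap.lTensor V Coalgebra.comul)
      (LinearMap.lTensor W Coalgebra.comul) z) := by
  have : LinearMap.lTensor (V ⊗[k] W) Coalgebra.comul ∘ₗ superStar 𝒜 𝒲 =
    superStar₂ 𝒜 𝒲 ∘ₗ (TensorProduct.map (LinearMap.lTensor V Coalgebra.comul)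
      (LinearMap.lTensor W Coalgebra.comul)) := by
    refine star_ext 𝒜 𝒲 fun v i h hh j w hw h' => ?_
    simp [superStar_hom v h' hh hw, superStar₂_hom v _ (HopfSuperalgebra.comul_mem i h hh) hw,
      comul_mul' 𝒜]
  exact LinearMap.congr_fun this z

lemma superStar_counit (z : (V ⊗[k] H) ⊗[k] (W ⊗[k] H)) :
    LinearMap.lTensor (V ⊗[k] W) Coalgebra.counit (superStar 𝒜 𝒲 z) =
    (TensorProduct.rid k (V ⊗[k] W)).symm
      (TensorProduct.map ((TensorProduct.rid k V).toLinearMap ∘ₗ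
          LinearMap.lTensor V Coalgebra.counit)
        ((TensorProduct.rid k W).toLinearMap ∘ₗ LinearMap.lTensor W Coalgebra.counit) z) := by
  have : LinearMap.lTensor (V ⊗[k] W) Coalgebra.counit ∘ₗ superStar 𝒜 𝒲 =
    (TensorProduct.rid k (V ⊗[k] W)).symm.toLinearMap ∘ₗ
      (TensorProduct.map ((TensorProduct.rid k V).toLinearMap ∘ₗ
          LinearMap.lTensor V Coalgebra.counit)
        ((TensorProduct.rid k W).toLinearMap ∘ₗ LinearMap.lTensor W Coalgebra.counit)) := by
    refine star_ext 𝒜 𝒲 fun v i h hh j w hw h' => ?_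
    have e := sgn_smul_counit (k := k) hh j
    simp only [LinearMap.comp_apply, superStar_hom v h' hh hw, map_smul,
      LinearMap.lTensor_tmul, HopfSuperalgebra.counit_mul (𝒜 := 𝒜), TensorProduct.map_tmul,
      LinearEquiv.coe_coe, TensorProduct.rid_tmul, TensorProduct.rid_symm_apply,
      ← TensorProduct.tmul_smul, smul_eq_mul, ← TensorProduct.smul_tmul', smul_smul]
    rw [← mul_assoc, e, mul_comm]
    simp only [TensorProduct.tmul_smul, ← TensorProduct.smul_tmul']
    rw [← TensorProduct.tmul_smul, smul_eq_mul, mul_one]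
  exact LinearMap.congr_fun this z

lemma superTensorCoact_coassoc {ρV : V →ₗ[k] V ⊗[k] H} {ρW : W →ₗ[k] W ⊗[k] H}
    (hρW : ∀ i, ∀ v ∈ 𝒲 i, ρW v ∈ tensorGrading 𝒲 𝒜 i)
    (hV : (TensorProduct.assoc k V H H).toLinearMap ∘ₗ ρV.rTensor H ∘ₗ ρV =
      LinearMap.lTensor V Coalgebra.comul ∘ₗ ρV)
    (hW : (TensorProduct.assoc k W H H).toLinearMap ∘ₗ ρW.rTensor H ∘ₗ ρW =
      LinearMap.lTensor W Coalgebra.comul ∘ₗ ρW) :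
    (TensorProduct.assoc k (V ⊗[k] W) H H).toLinearMap ∘ₗ
      (superTensorCoact 𝒜 𝒲 ρV ρW).rTensor H ∘ₗ superTensorCoact 𝒜 𝒲 ρV ρW =
    LinearMap.lTensor (V ⊗[k] W) Coalgebra.comul ∘ₗ superTensorCoact 𝒜 𝒲 ρV ρW := by
  have key : (TensorProduct.assoc k (V ⊗[k] W) H H).toLinearMap ∘ₗ
      (superTensorCoact 𝒜 𝒲 ρV ρW).rTensor H ∘ₗ superStar 𝒜 𝒲 =
      superStar₂ 𝒜 𝒲 ∘ₗ TensorProduct.map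
        ((TensorProduct.assoc k V H H).toLinearMap ∘ₗ ρV.rTensor H)
        ((TensorProduct.assoc k W H H).toLinearMap ∘ₗ ρW.rTensor H) := by
    refine star_ext 𝒜 𝒲 fun v i h hh j w hw h' => ?_
    simp [superStar_hom v h' hh hw, superTensorCoact,
      superStar_assoc (ρV v) h' hh (hρW j w hw)]
  refine TensorProduct.ext' fun v w => ?_
  have h1 := LinearMap.congr_fun key (ρV v ⊗ₜ ρW w)
  have hv := LinearMap.congr_fun hV v
  have hw := LinearMap.congr_fun hW w
  simp only [LinearMap.comp_apply, TensorProduct.map_tmul] at h1 hv hw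
  rw [hv, hw] at h1
  have h2 := superStar_comul (𝒜 := 𝒜) (𝒲 := 𝒲) (ρV v ⊗ₜ ρW w)
  rw [TensorProduct.map_tmul] at h2
  exact h1.trans h2.symm

lemma superTensorCoact_counit {ρV : V →ₗ[k] V ⊗[k] H} {ρW : W →ₗ[k] W ⊗[k] H}
    (hV : LinearMap.lTensor V Coalgebra.counit ∘ₗ ρV = (TensorProduct.mk k V k).flip 1)
    (hW : LinearMap.lTensor W Coalgebra.counit ∘ₗ ρW = (TensorProduct.mk k W k).flip 1) :
    LinearMap.lTensor (V ⊗[k] W) Coalgebra.counit ∘ₗ superTensorCoact 𝒜 𝒲 ρV ρW =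
      (TensorProduct.mk k (V ⊗[k] W) k).flip 1 := by
  ext v w
  have hv := LinearMap.congr_fun hV v
  have hw := LinearMap.congr_fun hW w
  simp only [LinearMap.comp_apply, LinearMap.flip_apply, TensorProduct.mk_apply] at hv hw
  have := superStar_counit (𝒜 := 𝒜) (𝒲 := 𝒲) (ρV v ⊗ₜ ρW w)
  simp only [TensorProduct.map_tmul, LinearMap.comp_apply, hv, hw] at this
  simpa [superTensorCoact] using this

end SuperTensor

section SuperTensorNaturality

variable {k : Type u} {H : Type v} [Field k] [Ring H] [Algebra k H]
variable {𝒜 : ZMod 2 → Submodule k H} [GradedAlgebra 𝒜]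
variable {V : Type*} [AddCommGroup V] [Module k V]
variable {V' : Type*} [AddCommGroup V'] [Module k V']
variable {W : Type*} [AddCommGroup W] [Module k W] {𝒲 : ZMod 2 → Submodule k W}
variable {W' : Type*} [AddCommGroup W'] [Module k W'] {𝒲' : ZMod 2 → Submodule k W'}
variable {X : Type*} [AddCommGroup X] [Module k X] {𝒳 : ZMod 2 → Submodule k X}
variable [DirectSum.Decomposition 𝒲] [DirectSum.Decomposition 𝒲'] [DirectSum.Decomposition 𝒳]

lemma superStar_naturality (f : V →ₗ[k] V') {g : W →ₗ[k] W'}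
    (hg : ∀ i, ∀ x ∈ 𝒲 i, g x ∈ 𝒲' i) (z : (V ⊗[k] H) ⊗[k] (W ⊗[k] H)) :
    superStar 𝒜 𝒲' (TensorProduct.map (f.rTensor H) (g.rTensor H) z) =
      (TensorProduct.map f g).rTensor H (superStar 𝒜 𝒲 z) := by
  have : superStar 𝒜 𝒲' ∘ₗ (TensorProduct.map (f.rTensor H) (g.rTensor H)) =
      (TensorProduct.map f g).rTensor H ∘ₗ (superStar 𝒜 𝒲) := by
    refine star_ext 𝒜 𝒲 fun v i h hh j w hw h' => ?_
    simp [superStar_hom v h' hh hw, superStar_hom (f v) h' hh (hg j w hw)]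
  exact LinearMap.congr_fun this z

lemma superStar_superStar (x : V ⊗[k] H) (y : W ⊗[k] H) (z : X ⊗[k] H) :
    (TensorProduct.assoc k V W X).toLinearMap.rTensor H
        (superStar 𝒜 𝒳 (superStar 𝒜 𝒲 (x ⊗ₜ y) ⊗ₜ z)) =
      superStar 𝒜 (tensorGrading 𝒲 𝒳) (x ⊗ₜ superStar 𝒜 𝒳 (y ⊗ₜ z)) := by
  have key : ∀ v : V, ∀ i, ∀ a ∈ 𝒜 i, ∀ j, ∀ w ∈ 𝒲 j, ∀ l, ∀ b ∈ 𝒜 l, ∀ m, ∀ t ∈ 𝒳 m, ∀ c : H,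
      (TensorProduct.assoc k V W X).toLinearMap.rTensor H
        (superStar 𝒜 𝒳 (superStar 𝒜 𝒲 ((v ⊗ₜ a) ⊗ₜ (w ⊗ₜ b)) ⊗ₜ (t ⊗ₜ c))) =
      superStar 𝒜 (tensorGrading 𝒲 𝒳) ((v ⊗ₜ a) ⊗ₜ superStar 𝒜 𝒳 ((w ⊗ₜ b) ⊗ₜ (t ⊗ₜ c))) := by
    intro v i a ha j w hw l b hb m t ht c
    have hab : a * b ∈ 𝒜 (i + l) := SetLike.mul_mem_graded ha hb
    rw [superStar_hom v b ha hw, superStar_hom w c hb ht, TensorProduct.tmul_smul, map_smul,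
      superStar_hom v _ ha (tmul_mem rfl hw ht), ← TensorProduct.smul_tmul', map_smul,
      superStar_hom _ c hab ht]
    simp only [map_smul, LinearMap.rTensor_tmul, LinearEquiv.coe_coe, TensorProduct.assoc_tmul,
      smul_smul, ← sgn_add, mul_assoc]
    congr 2
    ring
  induction x using TensorProduct.induction_on with
  | zero => simp
  | add x₁ x₂ h₁ h₂ => simp only [TensorProduct.add_tmul, map_add, h₁, h₂]
  | tmul v a =>
  induction y using TensorProduct.induction_on with
  | zero => simp
  | add x₁ x₂ h₁ h₂ => simp only [TensorProduct.add_tmul, TensorProduct.tmul_add, map_add, h₁, h₂]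
  | tmul w b =>
  induction z using TensorProduct.induction_on with
  | zero => simp
  | add x₁ x₂ h₁ h₂ => simp only [TensorProduct.tmul_add, map_add, h₁, h₂]
  | tmul t c =>
  rw [← proj_add 𝒜 a, ← proj_add 𝒲 w, ← proj_add 𝒜 b, ← proj_add 𝒳 t]
  simp only [TensorProduct.add_tmul, TensorProduct.tmul_add, map_add,
    key v _ _ (proj_mem 𝒜 _ a) _ _ (proj_mem 𝒲 _ w) _ _ (proj_mem 𝒜 _ b) _ _ (proj_mem 𝒳 _ t) c]

lemma superStar_unit_left (y : W ⊗[k] H) :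
    (TensorProduct.lid k W).toLinearMap.rTensor H
      (superStar 𝒜 𝒲 (((1 : k) ⊗ₜ (1 : H)) ⊗ₜ y)) = y := by
  have : (TensorProduct.lid k W).toLinearMap.rTensor H ∘ₗ superStar 𝒜 𝒲 ∘ₗ
      TensorProduct.mk k _ _ ((1 : k) ⊗ₜ (1 : H)) = LinearMap.id := by
    apply TensorProduct.ext
    refine hom_ext' 𝒲 fun j w hw => LinearMap.ext fun b => ?_
    simp [superStar_hom (1 : k) b (SetLike.one_mem_graded 𝒜) hw, sgn_zero]
  exact LinearMap.congr_fun this y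

lemma superStar_unit_right (x : V ⊗[k] H) :
    (TensorProduct.rid k V).toLinearMap.rTensor H
      (superStar 𝒜 (unitGrading k) (x ⊗ₜ ((1 : k) ⊗ₜ (1 : H)))) = x := by
  have h1 : (1 : k) ∈ unitGrading k 0 := by simp [unitGrading]
  have : (TensorProduct.rid k V).toLinearMap.rTensor H ∘ₗ superStar 𝒜 (unitGrading k) ∘ₗ
      (TensorProduct.mk k _ _).flip ((1 : k) ⊗ₜ (1 : H)) = LinearMap.id := by
    apply TensorProduct.ext
    refine LinearMap.ext fun v => hom_ext' 𝒜 fun i a ha => ?_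
    simp [superStar_hom v (1 : H) ha h1, sgn_zero]
  exact LinearMap.congr_fun this x

end SuperTensorNaturality

/-! ### The tensor category of finite-dimensional supercomodules -/

/-- A finite-dimensional (right) comodule, in super vector spaces, over the Hopf superalgebra with
grading `𝒜`: a finite-dimensional super vector space with an even coassociative counital
coaction. -/
structure SuperCorep {k : Type u} {H : Type v} [Field k] [Ring H] [Algebra k H] [Coalgebra k H]
    (𝒜 : ZMod 2 → Submodule k H) where
  /-- The underlying vector space. -/
  carrier : Type u
  [addCommGroup : AddCommGroup carrier]
  [module : Module k carrier]
  [finite : FiniteDimensional k carrier]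
  /-- The even and odd parts. -/
  grading : ZMod 2 → Submodule k carrier
  [decomposition : DirectSum.Decomposition grading]
  /-- The coaction. -/
  coact : carrier →ₗ[k] carrier ⊗[k] H
  coact_mem : ∀ i, ∀ x ∈ grading i, coact x ∈ tensorGrading grading 𝒜 i
  coassoc : (TensorProduct.assoc k carrier H H).toLinearMap ∘ₗ coact.rTensor H ∘ₗ coact =
    LinearMap.lTensor carrier Coalgebra.comul ∘ₗ coact
  counit : LinearMap.lTensor carrier Coalgebra.counit ∘ₗ coact = (TensorProduct.mk k carrier k).flip 1

namespace SuperCorep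

attribute [instance] addCommGroup module finite decomposition

variable {k : Type u} {H : Type v} [Field k] [Ring H] [Algebra k H] [Coalgebra k H]
variable {𝒜 : ZMod 2 → Submodule k H}

/-- The morphisms of supercomodules: even linear maps compatible with the coactions. -/
def homs (V W : SuperCorep 𝒜) : Submodule k (V.carrier →ₗ[k] W.carrier) where
  carrier := {f | (∀ i, ∀ x ∈ V.grading i, f x ∈ W.grading i) ∧
    f.rTensor H ∘ₗ V.coact = W.coact ∘ₗ f}
  zero_mem' := ⟨fun i x _ => by simp, by simp⟩
  add_mem' := fun {f g} hf hg => ⟨fun i x hx => Submodule.add_mem _ (hf.1 i x hx) (hg.1 i x hx), by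
    rw [LinearMap.rTensor_add, LinearMap.add_comp, LinearMap.comp_add, hf.2, hg.2]⟩
  smul_mem' := fun c f hf => ⟨fun i x hx => Submodule.smul_mem _ c (hf.1 i x hx), by
    rw [LinearMap.rTensor_smul, LinearMap.smul_comp, LinearMap.comp_smul, hf.2]⟩

instance : Category.{u} (SuperCorep 𝒜) where
  Hom V W := homs V W
  id V := ⟨LinearMap.id, fun _ _ hx => hx, by simp⟩
  comp f g := ⟨g.1 ∘ₗ f.1, fun i x hx => g.2.1 i _ (f.2.1 i x hx), by
    rw [LinearMap.rTensor_comp, LinearMap.comp_assoc, f.2.2, ← LinearMap.comp_assoc, g.2.2,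
      LinearMap.comp_assoc]⟩

@[ext]
lemma hom_ext {V W : SuperCorep 𝒜} {f g : V ⟶ W} (h : f.1 = g.1) : f = g := Subtype.ext h

@[simp] lemma id_val (V : SuperCorep 𝒜) : Subtype.val (𝟙 V) = LinearMap.id := rfl

@[simp] lemma comp_val {U V W : SuperCorep 𝒜} (f : U ⟶ V) (g : V ⟶ W) :
    (f ≫ g).1 = g.1 ∘ₗ f.1 := rfl

instance (V W : SuperCorep 𝒜) : AddCommGroup (V ⟶ W) := inferInstanceAs (AddCommGroup (homs V W))

instance (V W : SuperCorep 𝒜) : Module k (V ⟶ W) := inferInstanceAs (Module k (homs V W))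

@[simp] lemma add_val {V W : SuperCorep 𝒜} (f g : V ⟶ W) : (f + g).1 = f.1 + g.1 := rfl

@[simp] lemma smul_val {V W : SuperCorep 𝒜} (c : k) (f : V ⟶ W) : (c • f).1 = c • f.1 := rfl

instance : Preadditive (SuperCorep 𝒜) where
  add_comp _ _ _ f f' g := hom_ext (by simp [LinearMap.comp_add])
  comp_add _ _ _ f g g' := hom_ext (by simp [LinearMap.add_comp])

instance : Linear k (SuperCorep 𝒜) where
  smul_comp _ _ _ c f g := hom_ext (by simp [LinearMap.comp_smul])
  comp_smul _ _ _ f c g := hom_ext (by simp [LinearMap.smul_comp])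

/-- A bijective morphism is an isomorphism. -/
def mkIso {V W : SuperCorep 𝒜} (e : V.carrier ≃ₗ[k] W.carrier)
    (he : ∀ i, ∀ x ∈ V.grading i, e x ∈ W.grading i)
    (hc : e.toLinearMap.rTensor H ∘ₗ V.coact = W.coact ∘ₗ e.toLinearMap) : V ≅ W where
  hom := ⟨e.toLinearMap, he, hc⟩
  inv := ⟨e.symm.toLinearMap, symm_mem e he, by
    have h : e.symm.toLinearMap.rTensor H ∘ₗ e.toLinearMap.rTensor H = LinearMap.id := by
      rw [← LinearMap.rTensor_comp]; simp
    calc e.symm.toLinearMap.rTensor H ∘ₗ W.coact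
        = e.symm.toLinearMap.rTensor H ∘ₗ (W.coact ∘ₗ e.toLinearMap) ∘ₗ e.symm.toLinearMap := by
          congr 1; ext; simp
      _ = _ := by
          rw [← hc, ← LinearMap.comp_assoc, ← LinearMap.comp_assoc, h, LinearMap.id_comp]⟩
  hom_inv_id := hom_ext (by ext; simp)
  inv_hom_id := hom_ext (by ext; simp)

variable [GradedAlgebra 𝒜] [HopfSuperalgebra 𝒜]

/-- The tensor product of supercomodules. -/
def tensor (V W : SuperCorep 𝒜) : SuperCorep 𝒜 where
  carrier := V.carrier ⊗[k] W.carrier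
  grading := tensorGrading V.grading W.grading
  coact := superTensorCoact 𝒜 W.grading V.coact W.coact
  coact_mem := superTensorCoact_mem V.coact_mem W.coact_mem
  coassoc := superTensorCoact_coassoc W.coact_mem V.coassoc W.coassoc
  counit := superTensorCoact_counit V.counit W.counit

/-- The base field with the coaction `1 ↦ 1 ⊗ 1`. -/
def unit (𝒜 : ZMod 2 → Submodule k H) [GradedAlgebra 𝒜] [HopfSuperalgebra 𝒜] : SuperCorep 𝒜 where
  carrier := k
  grading := unitGrading k
  coact := (TensorProduct.mk k k H).flip 1
  coact_mem := fun i x hx => tmul_mem (add_zero i) hx (SetLike.one_mem_graded 𝒜)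
  coassoc := by ext; simp [HopfSuperalgebra.comul_one (𝒜 := 𝒜)]
  counit := by ext; simp [HopfSuperalgebra.counit_one (𝒜 := 𝒜)]

lemma unit_coact (c : k) : (unit 𝒜).coact c = c • ((1 : k) ⊗ₜ[k] (1 : H)) := by
  change c ⊗ₜ 1 = _
  rw [TensorProduct.smul_tmul', smul_eq_mul, mul_one]

/-- The tensor product of morphisms. -/
def tensorMap {V V' W W' : SuperCorep 𝒜} (f : V ⟶ V') (g : W ⟶ W') :
    tensor V W ⟶ tensor V' W' :=
  ⟨TensorProduct.map f.1 g.1, fun n t ht => by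
    refine map_tensor_mem (fun i j hij x hx y hy => ?_) ht
    exact tmul_mem hij (f.2.1 i x hx) (g.2.1 j y hy), by
    refine TensorProduct.ext' fun x y => ?_
    have hf := LinearMap.congr_fun f.2.2 x
    have hg := LinearMap.congr_fun g.2.2 y
    have := superStar_naturality (𝒜 := 𝒜) f.1 g.2.1 (V.coact x ⊗ₜ W.coact y)
    simp only [TensorProduct.map_tmul, LinearMap.comp_apply] at this hf hg
    rw [hf, hg] at this
    exact this.symm⟩

instance : MonoidalCategoryStruct (SuperCorep 𝒜) where
  tensorObj := tensor
  tensorUnit := unit 𝒜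
  tensorHom := tensorMap
  whiskerLeft V _ _ g := tensorMap (𝟙 V) g
  whiskerRight f W := tensorMap f (𝟙 W)
  associator U V W := mkIso (TensorProduct.assoc k U.carrier V.carrier W.carrier)
    (fun n t ht => by
      refine map_tensor_mem (f := (TensorProduct.assoc k _ _ _).toLinearMap)
        (fun i j hij x hx w hw => ?_) ht
      refine map_tensor_mem (f := (TensorProduct.assoc k _ _ _).toLinearMap ∘ₗ
        (TensorProduct.mk k _ _).flip w) (fun i' j' hij' y hy z hz => ?_) hx
      exact tmul_mem (by rw [← hij, ← hij', add_assoc]) hy (tmul_mem rfl hz hw))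
    (by
      refine TensorProduct.ext_threefold fun x y z => ?_
      exact superStar_superStar (U.coact x) (V.coact y) (W.coact z))
  leftUnitor V := mkIso (TensorProduct.lid k V.carrier)
    (fun n t ht => by
      refine map_tensor_mem (f := (TensorProduct.lid k _).toLinearMap)
        (fun i j hij c hc w hw => ?_) ht
      change c • w ∈ _
      by_cases hi : i = 0
      · subst hi; rw [← hij, zero_add]; exact Submodule.smul_mem _ c hw
      · have hc' : c ∈ unitGrading k i := hc
        have : c = 0 := by simpa [unitGrading, hi] using hc'
        simp [this])
    (by
      refine TensorProduct.ext' fun (c : k) y => ?_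
      have h := superStar_unit_left (𝒜 := 𝒜) (𝒲 := V.grading) (V.coact y)
      change (TensorProduct.lid k V.carrier).toLinearMap.rTensor H
        (superStar 𝒜 V.grading ((unit 𝒜).coact c ⊗ₜ V.coact y)) = V.coact (c • y)
      rw [unit_coact, ← TensorProduct.smul_tmul', map_smul, map_smul, map_smul]
      exact congrArg (c • ·) h)
  rightUnitor V := mkIso (TensorProduct.rid k V.carrier)
    (fun n t ht => by
      refine map_tensor_mem (f := (TensorProduct.rid k _).toLinearMap)
        (fun i j hij w hw c hc => ?_) ht
      change c • w ∈ _
      by_cases hj : j = 0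
      · subst hj; rw [← hij, add_zero]; exact Submodule.smul_mem _ c hw
      · have hc' : c ∈ unitGrading k j := hc
        have : c = 0 := by simpa [unitGrading, hj] using hc'
        simp [this])
    (by
      refine TensorProduct.ext' fun y (c : k) => ?_
      have h := superStar_unit_right (𝒜 := 𝒜) (V.coact y)
      change (TensorProduct.rid k V.carrier).toLinearMap.rTensor H
        (superStar 𝒜 (unitGrading k) (V.coact y ⊗ₜ (unit 𝒜).coact c)) = V.coact (c • y)
      rw [unit_coact, TensorProduct.tmul_smul, map_smul, map_smul, map_smul]
      exact congrArg (c • ·) h)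

instance : MonoidalCategory (SuperCorep 𝒜) where
  tensorHom_def f g := hom_ext (TensorProduct.ext' fun _ _ => rfl)
  id_tensorHom_id _ _ := hom_ext (TensorProduct.ext' fun _ _ => rfl)
  tensorHom_comp_tensorHom _ _ _ _ := hom_ext (TensorProduct.ext' fun _ _ => rfl)
  whiskerLeft_id _ _ := hom_ext (TensorProduct.ext' fun _ _ => rfl)
  id_whiskerRight _ _ := hom_ext (TensorProduct.ext' fun _ _ => rfl)
  associator_naturality _ _ _ := hom_ext (TensorProduct.ext_threefold fun _ _ _ => rfl)
  leftUnitor_naturality f := hom_ext (TensorProduct.ext' fun _ _ => (map_smul f.1 _ _).symm)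
  rightUnitor_naturality f := hom_ext (TensorProduct.ext' fun _ _ => (map_smul f.1 _ _).symm)
  pentagon _ _ _ _ := hom_ext (TensorProduct.ext_fourfold fun _ _ _ _ => rfl)
  triangle V W := hom_ext (TensorProduct.ext_threefold fun x (c : k) y =>
    (TensorProduct.smul_tmul (R := k) c x y).symm)

end SuperCorep

/-! ### The tensor category of finite-dimensional comodules over an ordinary bialgebra -/

section OrdinaryTensor

variable {k : Type u} {B : Type v} [Field k] [Ring B] [Algebra k B]
variable {C : Type*} [Ring C] [Algebra k C]
variable {V : Type*} [AddCommGroup V] [Module k V] {V' : Type*} [AddCommGroup V'] [Module k V']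
variable {W : Type*} [AddCommGroup W] [Module k W] {W' : Type*} [AddCommGroup W'] [Module k W']
variable {X : Type*} [AddCommGroup X] [Module k X]

/-- `(v ⊗ a) ⊗ (w ⊗ b) ↦ (v ⊗ w) ⊗ ab`. -/
noncomputable def star (k : Type u) [Field k] (B : Type*) [Ring B] [Algebra k B]
    (V : Type*) [AddCommGroup V] [Module k V] (W : Type*) [AddCommGroup W] [Module k W] :
    (V ⊗[k] B) ⊗[k] (W ⊗[k] B) →ₗ[k] (V ⊗[k] W) ⊗[k] B :=
  LinearMap.lTensor (V ⊗[k] W) (LinearMap.mul' k B) ∘ₗ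
    (TensorProduct.tensorTensorTensorComm k V B W B).toLinearMap

/-- The tensor product of two coactions: `v ⊗ w ↦ (v₀ ⊗ w₀) ⊗ v₁w₁`. -/
noncomputable def tensorCoact (ρV : V →ₗ[k] V ⊗[k] B) (ρW : W →ₗ[k] W ⊗[k] B) :
    V ⊗[k] W →ₗ[k] (V ⊗[k] W) ⊗[k] B :=
  star k B V W ∘ₗ TensorProduct.map ρV ρW

@[simp] lemma star_tmul (v : V) (a : B) (w : W) (b : B) :
    star k B V W ((v ⊗ₜ a) ⊗ₜ (w ⊗ₜ b)) = (v ⊗ₜ[k] w) ⊗ₜ[k] (a * b) := by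
  simp [star]

lemma star_hom_ext {N : Type*} [AddCommGroup N] [Module k N]
    {f g : (V ⊗[k] B) ⊗[k] (W ⊗[k] B) →ₗ[k] N}
    (h : ∀ v a w b, f ((v ⊗ₜ a) ⊗ₜ (w ⊗ₜ b)) = g ((v ⊗ₜ a) ⊗ₜ (w ⊗ₜ b))) : f = g := by
  apply TensorProduct.ext
  apply TensorProduct.ext
  refine LinearMap.ext fun v => LinearMap.ext fun a => ?_
  apply TensorProduct.ext
  exact LinearMap.ext fun w => LinearMap.ext fun b => h v a w b

lemma star_map (φ : B →ₗ[k] C) (hφ : ∀ a b, φ (a * b) = φ a * φ b)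
    (z : (V ⊗[k] B) ⊗[k] (W ⊗[k] B)) :
    φ.lTensor (V ⊗[k] W) (star k B V W z) =
      star k C V W (TensorProduct.map (φ.lTensor V) (φ.lTensor W) z) := by
  have : φ.lTensor (V ⊗[k] W) ∘ₗ star k B V W =
      star k C V W ∘ₗ TensorProduct.map (φ.lTensor V) (φ.lTensor W) :=
    star_hom_ext fun v a w b => by simp [hφ]
  exact LinearMap.congr_fun this z

lemma star_naturality (f : V →ₗ[k] V') (g : W →ₗ[k] W') (z : (V ⊗[k] B) ⊗[k] (W ⊗[k] B)) :
    star k B V' W' (TensorProduct.map (f.rTensor B) (g.rTensor B) z) =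
      (TensorProduct.map f g).rTensor B (star k B V W z) := by
  have : star k B V' W' ∘ₗ (TensorProduct.map (f.rTensor B) (g.rTensor B)) =
      (TensorProduct.map f g).rTensor B ∘ₗ (star k B V W) :=
    star_hom_ext fun v a w b => by simp
  exact LinearMap.congr_fun this z

lemma star_star (x : V ⊗[k] B) (y : W ⊗[k] B) (z : X ⊗[k] B) :
    (TensorProduct.assoc k V W X).toLinearMap.rTensor B
        (star k B (V ⊗[k] W) X (star k B V W (x ⊗ₜ y) ⊗ₜ z)) =
      star k B V (W ⊗[k] X) (x ⊗ₜ star k B W X (y ⊗ₜ z)) := by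
  induction x using TensorProduct.induction_on with
  | zero => simp
  | add x₁ x₂ h₁ h₂ => simp only [TensorProduct.add_tmul, map_add, h₁, h₂]
  | tmul v a =>
  induction y using TensorProduct.induction_on with
  | zero => simp
  | add x₁ x₂ h₁ h₂ => simp only [TensorProduct.add_tmul, TensorProduct.tmul_add, map_add, h₁, h₂]
  | tmul w b =>
  induction z using TensorProduct.induction_on with
  | zero => simp
  | add x₁ x₂ h₁ h₂ => simp only [TensorProduct.tmul_add, map_add, h₁, h₂]
  | tmul t c => simp [mul_assoc]

lemma star_assoc (x : V ⊗[k] B) (h : B) (y : W ⊗[k] B) (h' : B) :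
    star k (B ⊗[k] B) V W (TensorProduct.assoc k V B B (x ⊗ₜ h) ⊗ₜ
      TensorProduct.assoc k W B B (y ⊗ₜ h')) =
    TensorProduct.assoc k (V ⊗[k] W) B B (star k B V W (x ⊗ₜ y) ⊗ₜ (h * h')) := by
  induction x using TensorProduct.induction_on with
  | zero => simp
  | add x₁ x₂ h₁ h₂ => simp only [TensorProduct.add_tmul, map_add, h₁, h₂]
  | tmul v a =>
  induction y using TensorProduct.induction_on with
  | zero => simp
  | add x₁ x₂ h₁ h₂ => simp only [TensorProduct.add_tmul, TensorProduct.tmul_add, map_add, h₁, h₂]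
  | tmul w b => simp

end OrdinaryTensor

/-- A finite-dimensional (right) comodule over the bialgebra `B`. -/
structure Corep (k : Type u) (B : Type v) [Field k] [Ring B] [Bialgebra k B] where
  /-- The underlying vector space. -/
  carrier : Type u
  [addCommGroup : AddCommGroup carrier]
  [module : Module k carrier]
  [finite : FiniteDimensional k carrier]
  /-- The coaction. -/
  coact : carrier →ₗ[k] carrier ⊗[k] B
  coassoc : (TensorProduct.assoc k carrier B B).toLinearMap ∘ₗ coact.rTensor B ∘ₗ coact =
    LinearMap.lTensor carrier Coalgebra.comul ∘ₗ coact
  counit : LinearMap.lTensor carrier Coalgebra.counit ∘ₗ coact = (TensorProduct.mk k carrier k).flip 1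

namespace Corep

attribute [instance] addCommGroup module finite

variable {k : Type u} {B : Type v} [Field k] [Ring B] [Bialgebra k B]

/-- The morphisms of comodules: linear maps compatible with the coactions. -/
def homs (V W : Corep k B) : Submodule k (V.carrier →ₗ[k] W.carrier) where
  carrier := {f | f.rTensor B ∘ₗ V.coact = W.coact ∘ₗ f}
  zero_mem' := by simp
  add_mem' := fun {f g} (hf : _ = _) (hg : _ = _) => by
    change _ = _
    rw [LinearMap.rTensor_add, LinearMap.add_comp, LinearMap.comp_add, hf, hg]
  smul_mem' := fun c f (hf : _ = _) => by
    change _ = _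
    rw [LinearMap.rTensor_smul, LinearMap.smul_comp, LinearMap.comp_smul, hf]

lemma homs_comm {V W : Corep k B} (f : homs V W) : f.1.rTensor B ∘ₗ V.coact = W.coact ∘ₗ f.1 := f.2

instance : Category.{u} (Corep k B) where
  Hom V W := homs V W
  id V := ⟨LinearMap.id, by change _ = _; simp⟩
  comp f g := ⟨g.1 ∘ₗ f.1, by
    change _ = _
    rw [LinearMap.rTensor_comp, LinearMap.comp_assoc, homs_comm f, ← LinearMap.comp_assoc,
      homs_comm g, LinearMap.comp_assoc]⟩

@[ext]
lemma hom_ext {V W : Corep k B} {f g : V ⟶ W} (h : f.1 = g.1) : f = g := Subtype.ext h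

lemma hom_comm {V W : Corep k B} (f : V ⟶ W) : f.1.rTensor B ∘ₗ V.coact = W.coact ∘ₗ f.1 := f.2

@[simp] lemma id_val (V : Corep k B) : Subtype.val (𝟙 V) = LinearMap.id := rfl

@[simp] lemma comp_val {U V W : Corep k B} (f : U ⟶ V) (g : V ⟶ W) :
    (f ≫ g).1 = g.1 ∘ₗ f.1 := rfl

instance (V W : Corep k B) : AddCommGroup (V ⟶ W) := inferInstanceAs (AddCommGroup (homs V W))

instance (V W : Corep k B) : Module k (V ⟶ W) := inferInstanceAs (Module k (homs V W))

@[simp] lemma add_val {V W : Corep k B} (f g : V ⟶ W) : (f + g).1 = f.1 + g.1 := rfl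

@[simp] lemma smul_val {V W : Corep k B} (c : k) (f : V ⟶ W) : (c • f).1 = c • f.1 := rfl

instance : Preadditive (Corep k B) where
  add_comp _ _ _ f f' g := hom_ext (by simp [LinearMap.comp_add])
  comp_add _ _ _ f g g' := hom_ext (by simp [LinearMap.add_comp])

instance : Linear k (Corep k B) where
  smul_comp _ _ _ c f g := hom_ext (by simp [LinearMap.comp_smul])
  comp_smul _ _ _ f c g := hom_ext (by simp [LinearMap.smul_comp])

/-- A bijective morphism is an isomorphism. -/
def mkIso {V W : Corep k B} (e : V.carrier ≃ₗ[k] W.carrier)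
    (hc : e.toLinearMap.rTensor B ∘ₗ V.coact = W.coact ∘ₗ e.toLinearMap) : V ≅ W where
  hom := ⟨e.toLinearMap, hc⟩
  inv := ⟨e.symm.toLinearMap, by
    have h : e.symm.toLinearMap.rTensor B ∘ₗ e.toLinearMap.rTensor B = LinearMap.id := by
      rw [← LinearMap.rTensor_comp]; simp
    calc e.symm.toLinearMap.rTensor B ∘ₗ W.coact
        = e.symm.toLinearMap.rTensor B ∘ₗ (W.coact ∘ₗ e.toLinearMap) ∘ₗ e.symm.toLinearMap := by
          congr 1; ext; simp
      _ = _ := by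
          rw [← hc, ← LinearMap.comp_assoc, ← LinearMap.comp_assoc, h, LinearMap.id_comp]⟩
  hom_inv_id := hom_ext (by ext; simp)
  inv_hom_id := hom_ext (by ext; simp)

/-- The tensor product of comodules. -/
noncomputable def tensor (V W : Corep k B) : Corep k B where
  carrier := V.carrier ⊗[k] W.carrier
  coact := tensorCoact V.coact W.coact
  coassoc := by
    have key : (TensorProduct.assoc k (V.carrier ⊗[k] W.carrier) B B).toLinearMap ∘ₗ
        (tensorCoact V.coact W.coact).rTensor B ∘ₗ star k B V.carrier W.carrier =
        star k (B ⊗[k] B) V.carrier W.carrier ∘ₗ TensorProduct.map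
          ((TensorProduct.assoc k V.carrier B B).toLinearMap ∘ₗ V.coact.rTensor B)
          ((TensorProduct.assoc k W.carrier B B).toLinearMap ∘ₗ W.coact.rTensor B) :=
      star_hom_ext fun v a w b => by
        simp [tensorCoact, star_assoc (V.coact v) a (W.coact w) b]
    refine TensorProduct.ext' fun v w => ?_
    have h1 := LinearMap.congr_fun key (V.coact v ⊗ₜ W.coact w)
    have hv := LinearMap.congr_fun V.coassoc v
    have hw := LinearMap.congr_fun W.coassoc w
    simp only [LinearMap.comp_apply, TensorProduct.map_tmul] at h1 hv hw
    rw [hv, hw] at h1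
    have h2 := star_map (Coalgebra.comul (R := k) (A := B)) (fun a b => Bialgebra.comul_mul a b)
      (V.coact v ⊗ₜ W.coact w)
    rw [TensorProduct.map_tmul] at h2
    exact h1.trans h2.symm
  counit := by
    refine TensorProduct.ext' fun v w => ?_
    have hv := LinearMap.congr_fun V.counit v
    have hw := LinearMap.congr_fun W.counit w
    have h2 := star_map (Coalgebra.counit (R := k) (A := B)) (fun a b => Bialgebra.counit_mul a b)
      (V.coact v ⊗ₜ W.coact w)
    simp only [LinearMap.comp_apply, LinearMap.flip_apply, TensorProduct.mk_apply,
      TensorProduct.map_tmul] at hv hw h2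
    rw [hv, hw] at h2
    simpa [tensorCoact] using h2

/-- The base field with the coaction `1 ↦ 1 ⊗ 1`. -/
noncomputable def unit (k : Type u) (B : Type v) [Field k] [Ring B] [Bialgebra k B] : Corep k B where
  carrier := k
  coact := (TensorProduct.mk k k B).flip 1
  coassoc := by ext; simp [Algebra.TensorProduct.one_def]
  counit := by ext; simp

lemma unit_coact (c : k) : (unit k B).coact c = c • ((1 : k) ⊗ₜ[k] (1 : B)) := by
  change c ⊗ₜ 1 = _
  rw [TensorProduct.smul_tmul', smul_eq_mul, mul_one]

/-- The tensor product of morphisms. -/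
noncomputable def tensorMap {V V' W W' : Corep k B} (f : V ⟶ V') (g : W ⟶ W') :
    tensor V W ⟶ tensor V' W' :=
  ⟨TensorProduct.map f.1 g.1, by
    refine TensorProduct.ext' fun x y => ?_
    have hf := LinearMap.congr_fun (hom_comm f) x
    have hg := LinearMap.congr_fun (hom_comm g) y
    have := star_naturality f.1 g.1 (V.coact x ⊗ₜ W.coact y)
    simp only [TensorProduct.map_tmul, LinearMap.comp_apply] at this hf hg
    rw [hf, hg] at this
    exact this.symm⟩

noncomputable instance : MonoidalCategoryStruct (Corep k B) where
  tensorObj := tensor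
  tensorUnit := unit k B
  tensorHom := tensorMap
  whiskerLeft V _ _ g := tensorMap (𝟙 V) g
  whiskerRight f W := tensorMap f (𝟙 W)
  associator U V W := mkIso (TensorProduct.assoc k U.carrier V.carrier W.carrier)
    (by
      refine TensorProduct.ext_threefold fun x y z => ?_
      exact star_star (U.coact x) (V.coact y) (W.coact z))
  leftUnitor V := mkIso (TensorProduct.lid k V.carrier)
    (by
      refine TensorProduct.ext' fun (c : k) y => ?_
      change (TensorProduct.lid k V.carrier).toLinearMap.rTensor B
        (star k B k V.carrier ((unit k B).coact c ⊗ₜ V.coact y)) = V.coact (c • y)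
      rw [unit_coact, ← TensorProduct.smul_tmul', map_smul, map_smul, map_smul]
      congr 1
      generalize V.coact y = t
      induction t using TensorProduct.induction_on with
      | zero => simp
      | add a b ha hb => simp only [TensorProduct.tmul_add, map_add, ha, hb]
      | tmul a b => simp)
  rightUnitor V := mkIso (TensorProduct.rid k V.carrier)
    (by
      refine TensorProduct.ext' fun y (c : k) => ?_
      change (TensorProduct.rid k V.carrier).toLinearMap.rTensor B
        (star k B V.carrier k (V.coact y ⊗ₜ (unit k B).coact c)) = V.coact (c • y)
      rw [unit_coact, TensorProduct.tmul_smul, map_smul, map_smul, map_smul]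
      congr 1
      generalize V.coact y = t
      induction t using TensorProduct.induction_on with
      | zero => simp
      | add a b ha hb => simp only [TensorProduct.add_tmul, map_add, ha, hb]
      | tmul a b => simp)

noncomputable instance : MonoidalCategory (Corep k B) where
  tensorHom_def _ _ := hom_ext (TensorProduct.ext' fun _ _ => rfl)
  id_tensorHom_id _ _ := hom_ext (TensorProduct.ext' fun _ _ => rfl)
  tensorHom_comp_tensorHom _ _ _ _ := hom_ext (TensorProduct.ext' fun _ _ => rfl)
  whiskerLeft_id _ _ := hom_ext (TensorProduct.ext' fun _ _ => rfl)
  id_whiskerRight _ _ := hom_ext (TensorProduct.ext' fun _ _ => rfl)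
  associator_naturality _ _ _ := hom_ext (TensorProduct.ext_threefold fun _ _ _ => rfl)
  leftUnitor_naturality f := hom_ext (TensorProduct.ext' fun _ _ => (map_smul f.1 _ _).symm)
  rightUnitor_naturality f := hom_ext (TensorProduct.ext' fun _ _ => (map_smul f.1 _ _).symm)
  pentagon _ _ _ _ := hom_ext (TensorProduct.ext_fourfold fun _ _ _ _ => rfl)
  triangle _ _ := hom_ext (TensorProduct.ext_threefold fun x (c : k) y =>
    (TensorProduct.smul_tmul (R := k) c x y).symm)

end Corep

/-! ### The ordinary Hopf algebra attached to a Hopf superalgebra -/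

/-- The underlying vector space of the semidirect product `k[ℤ/2] ⋉ H`: the pair `(a, b)` stands
for `a + b g`, where `g` is the generator of `ℤ/2`. -/
def Bosonization {k : Type u} {H : Type v} [Field k] [Ring H] [Algebra k H]
    (_𝒜 : ZMod 2 → Submodule k H) : Type v := H × H

namespace Bosonization

section Ring

variable {k : Type u} {H : Type v} [Field k] [Ring H] [Algebra k H]
variable (𝒜 : ZMod 2 → Submodule k H)

instance : AddCommGroup (Bosonization 𝒜) := inferInstanceAs (AddCommGroup (H × H))

instance : Module k (Bosonization 𝒜) := inferInstanceAs (Module k (H × H))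

variable {𝒜}

@[ext] lemma ext {x y : Bosonization 𝒜} (h₁ : x.1 = y.1) (h₂ : x.2 = y.2) : x = y := Prod.ext h₁ h₂

@[simp] lemma add_fst (x y : Bosonization 𝒜) : (x + y).1 = x.1 + y.1 := rfl
@[simp] lemma add_snd (x y : Bosonization 𝒜) : (x + y).2 = x.2 + y.2 := rfl
@[simp] lemma zero_fst : (0 : Bosonization 𝒜).1 = 0 := rfl
@[simp] lemma zero_snd : (0 : Bosonization 𝒜).2 = 0 := rfl
@[simp] lemma smul_fst (c : k) (x : Bosonization 𝒜) : (c • x).1 = c • x.1 := rfl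
@[simp] lemma smul_snd (c : k) (x : Bosonization 𝒜) : (c • x).2 = c • x.2 := rfl

instance : One (Bosonization 𝒜) where
  one := (1, 0)

@[simp] lemma one_fst : (1 : Bosonization 𝒜).1 = 1 := rfl
@[simp] lemma one_snd : (1 : Bosonization 𝒜).2 = 0 := rfl

variable [GradedAlgebra 𝒜]

/-- The product of the semidirect product: `(a + b g)(c + d g)` is computed with `g c = σ(c) g` and
`g² = 1`, where `σ(c) = (-1)^|c| c`. -/
instance : Mul (Bosonization 𝒜) where
  mul x y := (x.1 * y.1 + x.2 * parity 𝒜 y.2, x.1 * y.2 + x.2 * parity 𝒜 y.1)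

@[simp] lemma mul_fst (x y : Bosonization 𝒜) : (x * y).1 = x.1 * y.1 + x.2 * parity 𝒜 y.2 := rfl
@[simp] lemma mul_snd (x y : Bosonization 𝒜) : (x * y).2 = x.1 * y.2 + x.2 * parity 𝒜 y.1 := rfl

instance : Ring (Bosonization 𝒜) :=
  { (inferInstance : AddCommGroup (Bosonization 𝒜)), (inferInstance : Mul (Bosonization 𝒜)),
    (inferInstance : One (Bosonization 𝒜)) with
    left_distrib := fun x y z => by ext <;> simp [mul_add] <;> abel
    right_distrib := fun x y z => by ext <;> simp [add_mul] <;> abel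
    zero_mul := fun x => by ext <;> simp
    mul_zero := fun x => by ext <;> simp
    mul_assoc := fun x y z => by
      ext <;> simp [mul_add, add_mul, parity_mul, parity_parity, mul_assoc] <;> abel
    one_mul := fun x => by ext <;> simp
    mul_one := fun x => by ext <;> simp [parity_one] }

instance : Algebra k (Bosonization 𝒜) :=
  Algebra.ofModule (fun c x y => by ext <;> simp [smul_add])
    (fun c x y => by ext <;> simp [smul_add])

/-- The inclusion of `H`. -/
def incl (𝒜 : ZMod 2 → Submodule k H) [GradedAlgebra 𝒜] : H →ₗ[k] Bosonization 𝒜 where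
  toFun a := (a, 0)
  map_add' _ _ := Prod.ext rfl (add_zero _).symm
  map_smul' c _ := Prod.ext rfl (smul_zero c).symm

/-- The generator of `ℤ/2`. -/
def gen (𝒜 : ZMod 2 → Submodule k H) [GradedAlgebra 𝒜] : Bosonization 𝒜 := ((0, 1) : H × H)

/-- The coordinates of `a + b g`. -/
def coordOne (𝒜 : ZMod 2 → Submodule k H) [GradedAlgebra 𝒜] : Bosonization 𝒜 →ₗ[k] H where
  toFun x := x.1
  map_add' _ _ := rfl
  map_smul' _ _ := rfl

/-- The coordinates of `a + b g`. -/
def coordGen (𝒜 : ZMod 2 → Submodule k H) [GradedAlgebra 𝒜] : Bosonization 𝒜 →ₗ[k] H where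
  toFun x := x.2
  map_add' _ _ := rfl
  map_smul' _ _ := rfl

@[simp] lemma incl_fst (a : H) : (incl 𝒜 a).1 = a := rfl
@[simp] lemma incl_snd (a : H) : (incl 𝒜 a).2 = 0 := rfl
@[simp] lemma gen_fst : (gen 𝒜).1 = 0 := rfl
@[simp] lemma gen_snd : (gen 𝒜).2 = 1 := rfl
@[simp] lemma coordOne_apply (x : Bosonization 𝒜) : coordOne 𝒜 x = x.1 := rfl
@[simp] lemma coordGen_apply (x : Bosonization 𝒜) : coordGen 𝒜 x = x.2 := rfl

lemma incl_mul (a b : H) : incl 𝒜 (a * b) = incl 𝒜 a * incl 𝒜 b := by ext <;> simp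

lemma incl_one : incl 𝒜 (1 : H) = 1 := rfl

lemma gen_mul_gen : gen 𝒜 * gen 𝒜 = 1 := by ext <;> simp [parity_one]

lemma gen_mul_incl (a : H) : gen 𝒜 * incl 𝒜 a = incl 𝒜 (parity 𝒜 a) * gen 𝒜 := by
  ext <;> simp [parity_one]

lemma eq_incl (x : Bosonization 𝒜) : x = incl 𝒜 x.1 + incl 𝒜 x.2 * gen 𝒜 := by
  ext <;> simp [parity_one]

/-- The powers `g^i`. -/
def genPow (𝒜 : ZMod 2 → Submodule k H) [GradedAlgebra 𝒜] (i : ZMod 2) : Bosonization 𝒜 := gen 𝒜 ^ i.val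

lemma genPow_zero : genPow 𝒜 0 = 1 := by simp [genPow]
lemma genPow_one : genPow 𝒜 1 = gen 𝒜 := by simp [genPow, ZMod.val_one]

lemma genPow_add (i j : ZMod 2) : genPow 𝒜 (i + j) = genPow 𝒜 i * genPow 𝒜 j := by
  have h2 : (1 : ZMod 2) + 1 = 0 := by decide
  rcases zmod2_cases i with rfl | rfl <;> rcases zmod2_cases j with rfl | rfl <;>
    simp [genPow_zero, genPow_one, h2, gen_mul_gen]

lemma genPow_self (i : ZMod 2) : genPow 𝒜 i * genPow 𝒜 i = 1 := by
  rcases zmod2_cases i with rfl | rfl <;> simp [genPow_zero, genPow_one, gen_mul_gen]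

/-- `g^j a = (-1)^(ij) a g^j` for `a` of degree `i`. -/
lemma genPow_mul_incl {i : ZMod 2} (j : ZMod 2) {a : H} (ha : a ∈ 𝒜 i) :
    genPow 𝒜 j * incl 𝒜 a = sgn k (i * j) • (incl 𝒜 a * genPow 𝒜 j) := by
  rcases zmod2_cases j with rfl | rfl
  · simp [genPow_zero, sgn_zero]
  · rw [genPow_one, gen_mul_incl, parity_eq ha, map_smul, smul_mul_assoc, mul_one]

lemma hom_ext {N : Type*} [AddCommGroup N] [Module k N] {f g : Bosonization 𝒜 →ₗ[k] N}
    (h : ∀ i, ∀ a ∈ 𝒜 i, ∀ e, f (incl 𝒜 a * genPow 𝒜 e) = g (incl 𝒜 a * genPow 𝒜 e)) : f = g := by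
  have h0 : f ∘ₗ incl 𝒜 = g ∘ₗ incl 𝒜 := hom_ext' 𝒜 fun i a ha => by
    simpa [genPow_zero] using h i a ha 0
  have h1 : f ∘ₗ LinearMap.mulRight k (gen 𝒜) ∘ₗ incl 𝒜 =
      g ∘ₗ LinearMap.mulRight k (gen 𝒜) ∘ₗ incl 𝒜 := hom_ext' 𝒜 fun i a ha => by
    simpa [genPow_one] using h i a ha 1
  ext x
  rw [eq_incl x, map_add, map_add]
  exact congrArg₂ _ (LinearMap.congr_fun h0 x.1) (LinearMap.congr_fun h1 x.2)

/-- The projection of `k[ℤ/2] ⋉ H` onto its part of degree `i`, where `|a g^e| = |a|`. -/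
def degProj (𝒜 : ZMod 2 → Submodule k H) [GradedAlgebra 𝒜] (i : ZMod 2) : Bosonization 𝒜 →ₗ[k] Bosonization 𝒜 :=
  incl 𝒜 ∘ₗ proj 𝒜 i ∘ₗ coordOne 𝒜 +
    LinearMap.mulRight k (gen 𝒜) ∘ₗ incl 𝒜 ∘ₗ proj 𝒜 i ∘ₗ coordGen 𝒜

lemma degProj_eq {i : ZMod 2} (j e : ZMod 2) {a : H} (ha : a ∈ 𝒜 i) :
    degProj 𝒜 j (incl 𝒜 a * genPow 𝒜 e) = if i = j then incl 𝒜 a * genPow 𝒜 e else 0 := by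
  rcases zmod2_cases e with rfl | rfl <;>
    · simp [degProj, genPow_zero, genPow_one, proj_eq ha, parity_one]
      split_ifs <;> simp

/-- Auxiliary: `b ⊗ c ↦ b g^|c| ⊗ c`. -/
def psi (𝒜 : ZMod 2 → Submodule k H) [GradedAlgebra 𝒜] : H ⊗[k] H →ₗ[k] Bosonization 𝒜 ⊗[k] Bosonization 𝒜 :=
  ∑ j : ZMod 2, TensorProduct.map (LinearMap.mulRight k (genPow 𝒜 j) ∘ₗ incl 𝒜)
    (incl 𝒜 ∘ₗ proj 𝒜 j)

lemma psi_hom {j : ZMod 2} (b : H) {c : H} (hc : c ∈ 𝒜 j) :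
    psi 𝒜 (b ⊗ₜ c) = (incl 𝒜 b * genPow 𝒜 j) ⊗ₜ incl 𝒜 c := by
  rcases zmod2_cases j with rfl | rfl <;>
    simp [psi, sum_zmod2, proj_eq hc, -Fin.sum_univ_two]

end Ring

section Hopf

variable {k : Type u} {H : Type v} [Field k] [Ring H] [Algebra k H]
variable (𝒜 : ZMod 2 → Submodule k H) [GradedAlgebra 𝒜] [Coalgebra k H]

/-- The comultiplication of the semidirect product Hopf superalgebra:
`a g^e ↦ Δ(a) (g^e ⊗ g^e)`. -/
def tildeComul : Bosonization 𝒜 →ₗ[k] Bosonization 𝒜 ⊗[k] Bosonization 𝒜 :=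
  TensorProduct.map (incl 𝒜) (incl 𝒜) ∘ₗ Coalgebra.comul ∘ₗ coordOne 𝒜 +
    TensorProduct.map (LinearMap.mulRight k (gen 𝒜) ∘ₗ incl 𝒜)
      (LinearMap.mulRight k (gen 𝒜) ∘ₗ incl 𝒜) ∘ₗ Coalgebra.comul ∘ₗ coordGen 𝒜

/-- The component `Δ̃ᵢ` of the comultiplication with values in `H̃ ⊗ H̃ᵢ`. -/
def tildeComulPart (i : ZMod 2) : Bosonization 𝒜 →ₗ[k] Bosonization 𝒜 ⊗[k] Bosonization 𝒜 :=
  (degProj 𝒜 i).lTensor (Bosonization 𝒜) ∘ₗ tildeComul 𝒜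

/-- The modified comultiplication `Δ(h) = Δ̃₀(h) - (-1)^|h| (g ⊗ 1) Δ̃₁(h)`. -/
def comul' : Bosonization 𝒜 →ₗ[k] Bosonization 𝒜 ⊗[k] Bosonization 𝒜 :=
  tildeComulPart 𝒜 0 - (LinearMap.mulLeft k (gen 𝒜)).rTensor (Bosonization 𝒜) ∘ₗ tildeComulPart 𝒜 1 ∘ₗ
    (degProj 𝒜 0 - degProj 𝒜 1)

/-- The counit `a g^e ↦ ε(a)`. -/
def counit' : Bosonization 𝒜 →ₗ[k] k :=
  Coalgebra.counit ∘ₗ coordOne 𝒜 + Coalgebra.counit ∘ₗ coordGen 𝒜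

/-- The antipode of the semidirect product Hopf superalgebra: `a g^e ↦ g^e S(a)`. -/
def tildeAntipode [HopfSuperalgebra 𝒜] : Bosonization 𝒜 →ₗ[k] Bosonization 𝒜 :=
  incl 𝒜 ∘ₗ HopfSuperalgebra.antipode 𝒜 ∘ₗ coordOne 𝒜 +
    LinearMap.mulLeft k (gen 𝒜) ∘ₗ incl 𝒜 ∘ₗ HopfSuperalgebra.antipode 𝒜 ∘ₗ coordGen 𝒜

/-- The modified antipode `S(h) = g^|h| S̃(h)`. -/
def antipode' [HopfSuperalgebra 𝒜] : Bosonization 𝒜 →ₗ[k] Bosonization 𝒜 :=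
  tildeAntipode 𝒜 ∘ₗ degProj 𝒜 0 + LinearMap.mulLeft k (gen 𝒜) ∘ₗ tildeAntipode 𝒜 ∘ₗ degProj 𝒜 1

variable {𝒜}

lemma tildeComul_eq (a : H) (e : ZMod 2) : tildeComul 𝒜 (incl 𝒜 a * genPow 𝒜 e) =
    TensorProduct.map (incl 𝒜) (incl 𝒜) (Coalgebra.comul a) * (genPow 𝒜 e ⊗ₜ genPow 𝒜 e) := by
  rcases zmod2_cases e with rfl | rfl
  · simp [tildeComul, genPow_zero, ← Algebra.TensorProduct.one_def]
  · simp only [tildeComul, genPow_one, LinearMap.add_apply, LinearMap.comp_apply, coordOne_apply,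
      coordGen_apply, mul_fst, mul_snd, incl_fst, incl_snd, gen_fst, gen_snd, parity_one, map_zero,
      mul_zero, add_zero, mul_one, zero_add]
    generalize Coalgebra.comul (R := k) a = t
    induction t using TensorProduct.induction_on with
    | zero => simp
    | add x y hx hy => simp only [map_add, add_mul, hx, hy]
    | tmul x y => simp

variable [HopfSuperalgebra 𝒜]

/-- The modified comultiplication is `a g^e ↦ a₁ g^(|a₂| + e) ⊗ a₂ g^e`. -/
lemma comul'_eq (a : H) (e : ZMod 2) : comul' 𝒜 (incl 𝒜 a * genPow 𝒜 e) =
    psi 𝒜 (Coalgebra.comul a) * (genPow 𝒜 e ⊗ₜ genPow 𝒜 e) := by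
  have key : ∀ i, ∀ a ∈ 𝒜 i, comul' 𝒜 (incl 𝒜 a * genPow 𝒜 e) =
      psi 𝒜 (Coalgebra.comul a) * (genPow 𝒜 e ⊗ₜ genPow 𝒜 e) := by
    intro i a ha
    have hpar : (degProj 𝒜 0 - degProj 𝒜 1) (incl 𝒜 a * genPow 𝒜 e) =
        sgn k i • (incl 𝒜 a * genPow 𝒜 e) := by
      rcases zmod2_cases i with rfl | rfl <;> simp [degProj_eq _ _ ha, sgn_zero, sgn_one]
    simp only [comul', tildeComulPart, LinearMap.sub_apply, LinearMap.comp_apply]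
    rw [← LinearMap.sub_apply, hpar, map_smul, map_smul, map_smul, tildeComul_eq]
    refine eqOn_tensor (n := i) (t := Coalgebra.comul a)
      (f := (degProj 𝒜 0).lTensor (Bosonization 𝒜) ∘ₗ
        LinearMap.mulRight k (genPow 𝒜 e ⊗ₜ genPow 𝒜 e) ∘ₗ
          TensorProduct.map (incl 𝒜) (incl 𝒜) -
        sgn k i • (LinearMap.mulLeft k (gen 𝒜)).rTensor (Bosonization 𝒜) ∘ₗ
          (degProj 𝒜 1).lTensor (Bosonization 𝒜) ∘ₗ
            LinearMap.mulRight k (genPow 𝒜 e ⊗ₜ genPow 𝒜 e) ∘ₗ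
              TensorProduct.map (incl 𝒜) (incl 𝒜))
      (g := LinearMap.mulRight k (genPow 𝒜 e ⊗ₜ genPow 𝒜 e) ∘ₗ psi 𝒜) ?_
      (HopfSuperalgebra.comul_mem i a ha)
    intro p q hpq b hb c hc
    simp only [LinearMap.sub_apply, LinearMap.smul_apply, LinearMap.comp_apply,
      TensorProduct.map_tmul, LinearMap.mulRight_apply, Algebra.TensorProduct.tmul_mul_tmul,
      LinearMap.lTensor_tmul, degProj_eq _ _ hc, LinearMap.rTensor_tmul, LinearMap.mulLeft_apply,
      psi_hom b hc, ← mul_assoc]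
    rcases zmod2_cases q with rfl | rfl
    · simp [genPow_zero]
    · have h := genPow_mul_incl (1 : ZMod 2) hb
      rw [genPow_one, mul_one] at h
      have hi : i = p + 1 := hpq.symm
      rw [h, hi, sgn_add]
      simp [genPow_one, sgn_one, ← TensorProduct.smul_tmul', smul_smul,
        sgn_mul_self]
  rw [← proj_add 𝒜 a]
  simp only [map_add, add_mul, key _ _ (proj_mem 𝒜 _ a)]

end Hopf

end Bosonization

namespace Bosonization

section HopfInstance

variable {k : Type u} {H : Type v} [Field k] [Ring H] [Algebra k H]
variable {𝒜 : ZMod 2 → Submodule k H} [GradedAlgebra 𝒜]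

lemma psi_mul (s t : H ⊗[k] H) : psi 𝒜 (superMul 𝒜 (s ⊗ₜ t)) = psi 𝒜 s * psi 𝒜 t := by
  have key : ∀ p, ∀ a ∈ 𝒜 p, ∀ q, ∀ b ∈ 𝒜 q, ∀ r, ∀ c ∈ 𝒜 r, ∀ m, ∀ d ∈ 𝒜 m,
      psi 𝒜 (superMul 𝒜 ((a ⊗ₜ b) ⊗ₜ (c ⊗ₜ d))) = psi 𝒜 (a ⊗ₜ b) * psi 𝒜 (c ⊗ₜ d) := by
    intro p a ha q b hb r c hc m d hd
    rw [superMul_hom a d hb hc, map_smul, psi_hom _ (SetLike.mul_mem_graded hb hd), psi_hom a hb,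
      psi_hom c hd, Algebra.TensorProduct.tmul_mul_tmul, incl_mul, incl_mul, genPow_add,
      mul_assoc (incl 𝒜 a) (genPow 𝒜 q), ← mul_assoc (genPow 𝒜 q) (incl 𝒜 c),
      genPow_mul_incl q hc, smul_mul_assoc, mul_smul_comm, ← TensorProduct.smul_tmul',
      mul_comm r q]
    simp only [mul_assoc]
  induction s using TensorProduct.induction_on with
  | zero => simp
  | add x₁ x₂ h₁ h₂ => simp only [TensorProduct.add_tmul, map_add, add_mul, h₁, h₂]
  | tmul a b =>
  induction t using TensorProduct.induction_on with
  | zero => simp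
  | add x₁ x₂ h₁ h₂ => simp only [TensorProduct.tmul_add, map_add, mul_add, h₁, h₂]
  | tmul c d =>
  rw [← proj_add 𝒜 a, ← proj_add 𝒜 b, ← proj_add 𝒜 c, ← proj_add 𝒜 d]
  simp only [TensorProduct.add_tmul, TensorProduct.tmul_add, map_add, add_mul, mul_add,
    key _ _ (proj_mem 𝒜 _ a) _ _ (proj_mem 𝒜 _ b) _ _ (proj_mem 𝒜 _ c) _ _ (proj_mem 𝒜 _ d)]

/-- `(g^e ⊗ g^e) ψ(t) = (-1)^(ei) ψ(t) (g^e ⊗ g^e)` for `t` of degree `i`. -/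
lemma genPow_mul_psi {i : ZMod 2} (e : ZMod 2) {t : H ⊗[k] H} (ht : t ∈ tensorGrading 𝒜 𝒜 i) :
    (genPow 𝒜 e ⊗ₜ[k] genPow 𝒜 e) * psi 𝒜 t =
      sgn k (i * e) • (psi 𝒜 t * (genPow 𝒜 e ⊗ₜ[k] genPow 𝒜 e)) := by
  refine eqOn_tensor (f := LinearMap.mulLeft k (genPow 𝒜 e ⊗ₜ[k] genPow 𝒜 e) ∘ₗ psi 𝒜)
    (g := sgn k (i * e) • LinearMap.mulRight k (genPow 𝒜 e ⊗ₜ[k] genPow 𝒜 e) ∘ₗ psi 𝒜) ?_ ht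
  intro p q hpq b hb c hc
  simp only [LinearMap.comp_apply, LinearMap.smul_apply, LinearMap.mulLeft_apply,
    LinearMap.mulRight_apply, psi_hom b hc, Algebra.TensorProduct.tmul_mul_tmul]
  rw [← mul_assoc, genPow_mul_incl e hb, genPow_mul_incl e hc, smul_mul_assoc,
    ← TensorProduct.smul_tmul', TensorProduct.tmul_smul, smul_smul, ← sgn_add, ← add_mul, hpq,
    mul_assoc, mul_assoc, ← genPow_add, ← genPow_add, add_comm]

variable [Coalgebra k H] [HopfSuperalgebra 𝒜]

lemma counit'_eq (a : H) (e : ZMod 2) :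
    counit' 𝒜 (incl 𝒜 a * genPow 𝒜 e) = Coalgebra.counit (R := k) a := by
  rcases zmod2_cases e with rfl | rfl <;>
    simp [counit', genPow_zero, genPow_one, parity_one]

lemma comul'_mul (x y : Bosonization 𝒜) : comul' 𝒜 (x * y) = comul' 𝒜 x * comul' 𝒜 y := by
  have key : ∀ i, ∀ a ∈ 𝒜 i, ∀ e, ∀ j, ∀ b ∈ 𝒜 j, ∀ f,
      comul' 𝒜 ((incl 𝒜 a * genPow 𝒜 e) * (incl 𝒜 b * genPow 𝒜 f)) =
      comul' 𝒜 (incl 𝒜 a * genPow 𝒜 e) * comul' 𝒜 (incl 𝒜 b * genPow 𝒜 f) := by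
    intro i a ha e j b hb f
    have h1 : (incl 𝒜 a * genPow 𝒜 e) * (incl 𝒜 b * genPow 𝒜 f) =
        sgn k (j * e) • (incl 𝒜 (a * b) * genPow 𝒜 (e + f)) := by
      rw [mul_assoc, ← mul_assoc (genPow 𝒜 e), genPow_mul_incl e hb, smul_mul_assoc,
        mul_smul_comm, incl_mul, genPow_add]
      simp only [mul_assoc]
    rw [h1, map_smul, comul'_eq, comul'_eq, comul'_eq, comul_mul' 𝒜, psi_mul,
      mul_assoc (psi 𝒜 _) (genPow 𝒜 e ⊗ₜ[k] genPow 𝒜 e), ← mul_assoc (genPow 𝒜 e ⊗ₜ[k] genPow 𝒜 e),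
      genPow_mul_psi e (HopfSuperalgebra.comul_mem j b hb), smul_mul_assoc, mul_smul_comm,
      genPow_add, ← Algebra.TensorProduct.tmul_mul_tmul]
    simp only [mul_assoc]
  have h := hom_ext (f := (LinearMap.mul k (Bosonization 𝒜)).compr₂ (comul' 𝒜))
    (g := (LinearMap.mul k (Bosonization 𝒜 ⊗[k] Bosonization 𝒜)).compl₁₂ (comul' 𝒜) (comul' 𝒜))
    (fun i a ha e => hom_ext fun j b hb f => key i a ha e j b hb f)
  exact LinearMap.congr_fun₂ h x y

lemma counit'_mul (x y : Bosonization 𝒜) : counit' 𝒜 (x * y) = counit' 𝒜 x * counit' 𝒜 y := by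
  have key : ∀ i, ∀ a ∈ 𝒜 i, ∀ e, ∀ j, ∀ b ∈ 𝒜 j, ∀ f,
      counit' 𝒜 ((incl 𝒜 a * genPow 𝒜 e) * (incl 𝒜 b * genPow 𝒜 f)) =
      counit' 𝒜 (incl 𝒜 a * genPow 𝒜 e) * counit' 𝒜 (incl 𝒜 b * genPow 𝒜 f) := by
    intro i a ha e j b hb f
    have h1 : (incl 𝒜 a * genPow 𝒜 e) * (incl 𝒜 b * genPow 𝒜 f) =
        sgn k (j * e) • (incl 𝒜 (a * b) * genPow 𝒜 (e + f)) := by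
      rw [mul_assoc, ← mul_assoc (genPow 𝒜 e), genPow_mul_incl e hb, smul_mul_assoc,
        mul_smul_comm, incl_mul, genPow_add]
      simp only [mul_assoc]
    rw [h1, map_smul, counit'_eq, counit'_eq, counit'_eq, HopfSuperalgebra.counit_mul (𝒜 := 𝒜),
      smul_eq_mul, mul_left_comm, sgn_smul_counit hb e]
  have h := hom_ext (f := (LinearMap.mul k (Bosonization 𝒜)).compr₂ (counit' 𝒜))
    (g := (LinearMap.mul k k).compl₁₂ (counit' 𝒜) (counit' 𝒜))
    (fun i a ha e => hom_ext fun j b hb f => key i a ha e j b hb f)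
  exact LinearMap.congr_fun₂ h x y

/-- Iterated comultiplications, for coassociativity. -/
lemma psi_coassoc (t : H ⊗[k] H) (e : ZMod 2) :
    TensorProduct.assoc k (Bosonization 𝒜) (Bosonization 𝒜) (Bosonization 𝒜)
        ((comul' 𝒜).rTensor (Bosonization 𝒜) (psi 𝒜 t * (genPow 𝒜 e ⊗ₜ[k] genPow 𝒜 e))) =
      ∑ j : ZMod 2, ∑ l : ZMod 2,
        TensorProduct.map (LinearMap.mulRight k (genPow 𝒜 (j + l + e)) ∘ₗ incl 𝒜)
          (TensorProduct.map (LinearMap.mulRight k (genPow 𝒜 (l + e)) ∘ₗ incl 𝒜 ∘ₗ proj 𝒜 j)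
            (LinearMap.mulRight k (genPow 𝒜 e) ∘ₗ incl 𝒜 ∘ₗ proj 𝒜 l))
          (TensorProduct.assoc k H H H (Coalgebra.comul.rTensor H t)) := by
  have key : ∀ l, ∀ c ∈ 𝒜 l, ∀ b, TensorProduct.assoc k (Bosonization 𝒜) (Bosonization 𝒜) (Bosonization 𝒜)
        ((comul' 𝒜).rTensor (Bosonization 𝒜) (psi 𝒜 (b ⊗ₜ c) * (genPow 𝒜 e ⊗ₜ[k] genPow 𝒜 e))) =
      ∑ j : ZMod 2, ∑ l : ZMod 2,
        TensorProduct.map (LinearMap.mulRight k (genPow 𝒜 (j + l + e)) ∘ₗ incl 𝒜)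
          (TensorProduct.map (LinearMap.mulRight k (genPow 𝒜 (l + e)) ∘ₗ incl 𝒜 ∘ₗ proj 𝒜 j)
            (LinearMap.mulRight k (genPow 𝒜 e) ∘ₗ incl 𝒜 ∘ₗ proj 𝒜 l))
          (TensorProduct.assoc k H H H (Coalgebra.comul.rTensor H (b ⊗ₜ c))) := by
    intro l c hc b
    rw [psi_hom b hc, Algebra.TensorProduct.tmul_mul_tmul, mul_assoc, ← genPow_add,
      LinearMap.rTensor_tmul, comul'_eq, LinearMap.rTensor_tmul]
    generalize Coalgebra.comul (R := k) b = s
    induction s using TensorProduct.induction_on with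
    | zero => simp
    | add x y hx hy =>
      simp only [map_add, add_mul, TensorProduct.add_tmul, hx, hy, Finset.sum_add_distrib]
    | tmul x y =>
    have hx : ∀ j, ∀ y ∈ 𝒜 j, TensorProduct.assoc k (Bosonization 𝒜) (Bosonization 𝒜) (Bosonization 𝒜)
        ((psi 𝒜 (x ⊗ₜ y) * (genPow 𝒜 (l + e) ⊗ₜ[k] genPow 𝒜 (l + e))) ⊗ₜ
          (incl 𝒜 c * genPow 𝒜 e)) = (incl 𝒜 x * genPow 𝒜 (j + l + e)) ⊗ₜ
          ((incl 𝒜 y * genPow 𝒜 (l + e)) ⊗ₜ (incl 𝒜 c * genPow 𝒜 e)) := by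
      intro j y hy
      rw [psi_hom x hy, Algebra.TensorProduct.tmul_mul_tmul, mul_assoc, ← genPow_add,
        TensorProduct.assoc_tmul, add_assoc]
    conv_lhs => rw [← proj_add 𝒜 y]
    rw [TensorProduct.tmul_add, map_add, add_mul, TensorProduct.add_tmul, map_add,
      hx 0 _ (proj_mem 𝒜 0 y), hx 1 _ (proj_mem 𝒜 1 y), sum_zmod2, sum_zmod2, sum_zmod2]
    rcases zmod2_cases l with rfl | rfl <;> simp [proj_eq hc]
  induction t using TensorProduct.induction_on with
  | zero => simp
  | add x₁ x₂ h₁ h₂ => simp only [map_add, add_mul, h₁, h₂, Finset.sum_add_distrib]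
  | tmul b c =>
  rw [← proj_add 𝒜 c]
  simp only [TensorProduct.tmul_add, map_add, add_mul, key _ _ (proj_mem 𝒜 _ c),
    Finset.sum_add_distrib]

lemma psi_coassoc' (t : H ⊗[k] H) (e : ZMod 2) :
    (comul' 𝒜).lTensor (Bosonization 𝒜) (psi 𝒜 t * (genPow 𝒜 e ⊗ₜ[k] genPow 𝒜 e)) =
      ∑ j : ZMod 2, ∑ l : ZMod 2,
        TensorProduct.map (LinearMap.mulRight k (genPow 𝒜 (j + l + e)) ∘ₗ incl 𝒜)
          (TensorProduct.map (LinearMap.mulRight k (genPow 𝒜 (l + e)) ∘ₗ incl 𝒜 ∘ₗ proj 𝒜 j)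
            (LinearMap.mulRight k (genPow 𝒜 e) ∘ₗ incl 𝒜 ∘ₗ proj 𝒜 l))
          (Coalgebra.comul.lTensor H t) := by
  have key : ∀ n, ∀ c ∈ 𝒜 n, ∀ b,
      (comul' 𝒜).lTensor (Bosonization 𝒜) (psi 𝒜 (b ⊗ₜ c) * (genPow 𝒜 e ⊗ₜ[k] genPow 𝒜 e)) =
      ∑ j : ZMod 2, ∑ l : ZMod 2,
        TensorProduct.map (LinearMap.mulRight k (genPow 𝒜 (j + l + e)) ∘ₗ incl 𝒜)
          (TensorProduct.map (LinearMap.mulRight k (genPow 𝒜 (l + e)) ∘ₗ incl 𝒜 ∘ₗ proj 𝒜 j)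
            (LinearMap.mulRight k (genPow 𝒜 e) ∘ₗ incl 𝒜 ∘ₗ proj 𝒜 l))
          (Coalgebra.comul.lTensor H (b ⊗ₜ c)) := by
    intro n c hc b
    rw [psi_hom b hc, Algebra.TensorProduct.tmul_mul_tmul, mul_assoc, ← genPow_add,
      LinearMap.lTensor_tmul, comul'_eq, LinearMap.lTensor_tmul]
    refine eqOn_tensor (n := n) (t := Coalgebra.comul c)
      (f := TensorProduct.mk k _ _ (incl 𝒜 b * genPow 𝒜 (n + e)) ∘ₗ
        LinearMap.mulRight k (genPow 𝒜 e ⊗ₜ[k] genPow 𝒜 e) ∘ₗ psi 𝒜)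
      (g := (∑ j : ZMod 2, ∑ l : ZMod 2,
        TensorProduct.map (LinearMap.mulRight k (genPow 𝒜 (j + l + e)) ∘ₗ incl 𝒜)
          (TensorProduct.map (LinearMap.mulRight k (genPow 𝒜 (l + e)) ∘ₗ incl 𝒜 ∘ₗ proj 𝒜 j)
            (LinearMap.mulRight k (genPow 𝒜 e) ∘ₗ incl 𝒜 ∘ₗ proj 𝒜 l))) ∘ₗ
          TensorProduct.mk k _ _ b) ?_
      (HopfSuperalgebra.comul_mem n c hc) |>.trans ?_
    · intro p q hpq x hx y hy
      rw [← hpq]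
      simp only [LinearMap.comp_apply, TensorProduct.mk_apply, psi_hom x hy,
        LinearMap.mulRight_apply, Algebra.TensorProduct.tmul_mul_tmul, mul_assoc, ← genPow_add]
      rw [sum_zmod2, sum_zmod2, sum_zmod2]
      rcases zmod2_cases p with rfl | rfl <;> rcases zmod2_cases q with rfl | rfl <;>
        simp [proj_eq hx, proj_eq hy]
    · simp only [LinearMap.comp_apply, LinearMap.sum_apply, TensorProduct.mk_apply]
  induction t using TensorProduct.induction_on with
  | zero => simp
  | add x₁ x₂ h₁ h₂ => simp only [map_add, add_mul, h₁, h₂, Finset.sum_add_distrib]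
  | tmul b c =>
  rw [← proj_add 𝒜 c]
  simp only [TensorProduct.tmul_add, map_add, add_mul, key _ _ (proj_mem 𝒜 _ c),
    Finset.sum_add_distrib]

lemma psi_counit_left (t : H ⊗[k] H) (e : ZMod 2) :
    (counit' 𝒜).rTensor (Bosonization 𝒜) (psi 𝒜 t * (genPow 𝒜 e ⊗ₜ[k] genPow 𝒜 e)) =
      (LinearMap.mulRight k (genPow 𝒜 e) ∘ₗ incl 𝒜).lTensor k
        (Coalgebra.counit.rTensor H t) := by
  have h : (counit' 𝒜).rTensor (Bosonization 𝒜) ∘ₗ LinearMap.mulRight k (genPow 𝒜 e ⊗ₜ[k] genPow 𝒜 e) ∘ₗ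
      psi 𝒜 = (LinearMap.mulRight k (genPow 𝒜 e) ∘ₗ incl 𝒜).lTensor k ∘ₗ
        Coalgebra.counit.rTensor H := by
    refine tensor_ext 𝒜 𝒜 fun i j b hb c hc => ?_
    simp only [LinearMap.comp_apply, LinearMap.mulRight_apply, psi_hom b hc,
      Algebra.TensorProduct.tmul_mul_tmul, mul_assoc, ← genPow_add, LinearMap.rTensor_tmul,
      LinearMap.lTensor_tmul, counit'_eq]
  exact LinearMap.congr_fun h t

lemma psi_counit_right (t : H ⊗[k] H) (e : ZMod 2) :
    (counit' 𝒜).lTensor (Bosonization 𝒜) (psi 𝒜 t * (genPow 𝒜 e ⊗ₜ[k] genPow 𝒜 e)) =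
      (LinearMap.mulRight k (genPow 𝒜 e) ∘ₗ incl 𝒜).rTensor k
        (Coalgebra.counit.lTensor H t) := by
  have h : (counit' 𝒜).lTensor (Bosonization 𝒜) ∘ₗ LinearMap.mulRight k (genPow 𝒜 e ⊗ₜ[k] genPow 𝒜 e) ∘ₗ
      psi 𝒜 = (LinearMap.mulRight k (genPow 𝒜 e) ∘ₗ incl 𝒜).rTensor k ∘ₗ
        Coalgebra.counit.lTensor H := by
    refine tensor_ext 𝒜 𝒜 fun i j b hb c hc => ?_
    simp only [LinearMap.comp_apply, LinearMap.mulRight_apply, psi_hom b hc,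
      Algebra.TensorProduct.tmul_mul_tmul, mul_assoc, ← genPow_add, LinearMap.rTensor_tmul,
      LinearMap.lTensor_tmul, counit'_eq]
    rcases zmod2_cases j with rfl | rfl
    · rw [zero_add]
    · rw [counit_eq hc (by decide), TensorProduct.tmul_zero, TensorProduct.tmul_zero]
  exact LinearMap.congr_fun h t

noncomputable instance : Coalgebra k (Bosonization 𝒜) where
  comul := comul' 𝒜
  counit := counit' 𝒜
  coassoc := hom_ext fun i a ha e => by
    simp only [LinearMap.comp_apply, LinearEquiv.coe_coe, comul'_eq]
    rw [psi_coassoc, psi_coassoc', Coalgebra.coassoc_apply]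
  rTensor_counit_comp_comul := hom_ext fun i a ha e => by
    simp only [LinearMap.comp_apply, comul'_eq]
    rw [psi_counit_left, Coalgebra.rTensor_counit_comul]
    simp
  lTensor_counit_comp_comul := hom_ext fun i a ha e => by
    simp only [LinearMap.comp_apply, comul'_eq]
    rw [psi_counit_right, Coalgebra.lTensor_counit_comul]
    simp

lemma comul_def (x : Bosonization 𝒜) : Coalgebra.comul (R := k) x = comul' 𝒜 x := rfl

lemma counit_def (x : Bosonization 𝒜) : Coalgebra.counit (R := k) x = counit' 𝒜 x := rfl

noncomputable instance : Bialgebra k (Bosonization 𝒜) :=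
  Bialgebra.mk' k (Bosonization 𝒜)
    (by
      have h := counit'_eq (𝒜 := 𝒜) (1 : H) 0
      rw [genPow_zero, mul_one, incl_one, HopfSuperalgebra.counit_one (𝒜 := 𝒜)] at h
      exact h)
    (fun {a b} => counit'_mul a b)
    (by
      have h := comul'_eq (𝒜 := 𝒜) (1 : H) 0
      rw [genPow_zero, mul_one, incl_one, HopfSuperalgebra.comul_one (𝒜 := 𝒜),
        psi_hom 1 (SetLike.one_mem_graded 𝒜), genPow_zero, mul_one, incl_one] at h
      rw [comul_def, h, ← Algebra.TensorProduct.one_def, mul_one])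
    (fun {a b} => comul'_mul a b)

lemma tildeAntipode_eq (a : H) (e : ZMod 2) : tildeAntipode 𝒜 (incl 𝒜 a * genPow 𝒜 e) =
    genPow 𝒜 e * incl 𝒜 (HopfSuperalgebra.antipode 𝒜 a) := by
  rcases zmod2_cases e with rfl | rfl <;>
    simp [tildeAntipode, genPow_zero, genPow_one, parity_one]

lemma antipode'_eq {i : ZMod 2} {a : H} (ha : a ∈ 𝒜 i) (e : ZMod 2) :
    antipode' 𝒜 (incl 𝒜 a * genPow 𝒜 e) =
      genPow 𝒜 (i + e) * incl 𝒜 (HopfSuperalgebra.antipode 𝒜 a) := by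
  rw [genPow_add]
  rcases zmod2_cases i with rfl | rfl <;>
    simp [antipode', degProj_eq _ _ ha, tildeAntipode_eq, genPow_zero, genPow_one, mul_assoc]

lemma psi_antipode_left {i : ZMod 2} {t : H ⊗[k] H} (ht : t ∈ tensorGrading 𝒜 𝒜 i) (e : ZMod 2) :
    LinearMap.mul' k (Bosonization 𝒜) ((antipode' 𝒜).rTensor (Bosonization 𝒜)
      (psi 𝒜 t * (genPow 𝒜 e ⊗ₜ[k] genPow 𝒜 e))) =
    genPow 𝒜 (i + e) * incl 𝒜 (LinearMap.mul' k H
      ((HopfSuperalgebra.antipode 𝒜).rTensor H t)) * genPow 𝒜 e := by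
  refine eqOn_tensor (f := LinearMap.mul' k (Bosonization 𝒜) ∘ₗ (antipode' 𝒜).rTensor (Bosonization 𝒜) ∘ₗ
      LinearMap.mulRight k (genPow 𝒜 e ⊗ₜ[k] genPow 𝒜 e) ∘ₗ psi 𝒜)
    (g := LinearMap.mulRight k (genPow 𝒜 e) ∘ₗ LinearMap.mulLeft k (genPow 𝒜 (i + e)) ∘ₗ
      incl 𝒜 ∘ₗ LinearMap.mul' k H ∘ₗ (HopfSuperalgebra.antipode 𝒜).rTensor H) ?_ ht
  intro p q hpq b hb c hc
  simp only [LinearMap.comp_apply, LinearMap.mulRight_apply, psi_hom b hc,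
    Algebra.TensorProduct.tmul_mul_tmul, LinearMap.rTensor_tmul, LinearMap.mul'_apply,
    LinearMap.mulLeft_apply, mul_assoc, ← genPow_add, antipode'_eq hb, incl_mul]
  rw [← hpq, add_assoc]

lemma psi_antipode_right (t : H ⊗[k] H) (e : ZMod 2) :
    LinearMap.mul' k (Bosonization 𝒜) ((antipode' 𝒜).lTensor (Bosonization 𝒜)
      (psi 𝒜 t * (genPow 𝒜 e ⊗ₜ[k] genPow 𝒜 e))) =
    incl 𝒜 (LinearMap.mul' k H ((HopfSuperalgebra.antipode 𝒜).lTensor H t)) := by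
  have h : LinearMap.mul' k (Bosonization 𝒜) ∘ₗ (antipode' 𝒜).lTensor (Bosonization 𝒜) ∘ₗ
      LinearMap.mulRight k (genPow 𝒜 e ⊗ₜ[k] genPow 𝒜 e) ∘ₗ psi 𝒜 =
      incl 𝒜 ∘ₗ LinearMap.mul' k H ∘ₗ (HopfSuperalgebra.antipode 𝒜).lTensor H := by
    refine tensor_ext 𝒜 𝒜 fun i j b hb c hc => ?_
    simp only [LinearMap.comp_apply, LinearMap.mulRight_apply, psi_hom b hc,
      Algebra.TensorProduct.tmul_mul_tmul, LinearMap.lTensor_tmul, LinearMap.mul'_apply,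
      antipode'_eq hc, incl_mul]
    rw [mul_assoc, mul_assoc, ← mul_assoc (genPow 𝒜 e), ← genPow_add,
      ← mul_assoc (genPow 𝒜 j), ← genPow_add,
      show j + (e + (j + e)) = (j + e) + (j + e) by ring, genPow_add, genPow_self, one_mul]
  exact LinearMap.congr_fun h t

lemma incl_algebraMap (c : k) : incl 𝒜 (algebraMap k H c) = algebraMap k (Bosonization 𝒜) c := by
  rw [Algebra.algebraMap_eq_smul_one, Algebra.algebraMap_eq_smul_one, map_smul, incl_one]

/-- The ordinary Hopf algebra `H' = k[ℤ/2] ⋉ H` with the modified comultiplication and antipode. -/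
noncomputable instance : HopfAlgebra k (Bosonization 𝒜) where
  antipode := antipode' 𝒜
  mul_antipode_rTensor_comul := hom_ext fun i a ha e => by
    have h := LinearMap.congr_fun (HopfSuperalgebra.mul_antipode_rTensor_comul (𝒜 := 𝒜)) a
    simp only [LinearMap.comp_apply, Algebra.linearMap_apply] at h
    simp only [LinearMap.comp_apply, comul_def, comul'_eq, counit_def, counit'_eq,
      Algebra.linearMap_apply]
    rw [psi_antipode_left (HopfSuperalgebra.comul_mem i a ha), h, incl_algebraMap]
    by_cases hi : i = 0
    · rw [hi, zero_add, ← Algebra.commutes, mul_assoc, genPow_self, mul_one]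
    · rw [counit_eq ha hi]; simp
  mul_antipode_lTensor_comul := hom_ext fun i a ha e => by
    have h := LinearMap.congr_fun (HopfSuperalgebra.mul_antipode_lTensor_comul (𝒜 := 𝒜)) a
    simp only [LinearMap.comp_apply, Algebra.linearMap_apply] at h
    simp only [LinearMap.comp_apply, comul_def, comul'_eq, counit_def, counit'_eq,
      Algebra.linearMap_apply]
    rw [psi_antipode_right, h, incl_algebraMap]

end HopfInstance

end Bosonization

end SuperHopf

/-! Write H' for `Bosonization 𝒜`. Its comultiplication is a g^e ↦ a₁ g^(|a₂|+e) ⊗ a₂ g^e. Two maps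
out of H' therefore respect the coalgebra structures: erasing the power of g, with values in H
(`map_forget_comul`, `counit_forget`), and a g^e ↦ ε(a) g^e, with values in k[ℤ/2], because ε kills
odd elements. Accordingly an H'-comodule carries an H-coaction and a k[ℤ/2]-coaction, the latter
being the same thing as a ℤ/2-grading. The grading is handled through the functionals `coordCounit
0` and `coordCounit 1` on H', which slice a coaction into its two homogeneous components.

Coassociativity ties the two structures together. Slicing one leg of the comultiplication shows that
a vector of degree i coacts through W ⊗ H g^i (`coact_degreeProj`). Slicing the other leg shows that
a vector paired with a coefficient a g^e has degree |a| + e (`degreeProj_rTensor_coact`). Taking e =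
i, the H-coaction is even. Moreover the exponent of g is dictated by the degree, so the H'-coaction
is w ↦ w₀ ⊗ w₁ g^|w| and nothing is lost (`bosonCoact_forgetCoact`). Conversely that formula turns
every even H-coaction into an H'-coaction (`bosonCoact_coassoc`). Both kinds of comodule are thus
the same data on one vector space, with the same morphisms, and the functor does not change linear
maps.

Only the tensor products differ. In H', moving g^|v| past w₁ costs (-1)^(|v||w₁|), while the super
tensor product has the sign (-1)^(|v₁||w₀|). The quotient of these signs is (-1)^(|v||w| +
|v₀||w₀|), which is exactly what conjugation by v ⊗ w ↦ (-1)^(|v||w|) v ⊗ w absorbs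
(`signTwist_bosonCoact`). Since |v||w| is biadditive in the degrees, this twist is coherent with the
associators (`assoc_signTwist`), and it is trivial against the even unit object. -/

namespace SuperHopf

/-! ### The sign twist on a tensor product of super vector spaces -/

section SignTwist

variable {k : Type u} [Field k]
variable {V : Type*} [AddCommGroup V] [Module k V] (𝒱 : ZMod 2 → Submodule k V)
variable {W : Type*} [AddCommGroup W] [Module k W] (𝒲 : ZMod 2 → Submodule k W)
variable [DirectSum.Decomposition 𝒱] [DirectSum.Decomposition 𝒲]

/-- The automorphism `v ⊗ w ↦ (-1)^(|v||w|) v ⊗ w` of `V ⊗ W`, as a linear map. -/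
def signTwist : V ⊗[k] W →ₗ[k] V ⊗[k] W :=
  (TensorProduct.comm k W V).toLinearMap ∘ₗ superBraid 𝒱 𝒲

variable {𝒱 𝒲}

lemma signTwist_hom {i j : ZMod 2} {x : V} {y : W} (hx : x ∈ 𝒱 i) (hy : y ∈ 𝒲 j) :
    signTwist 𝒱 𝒲 (x ⊗ₜ y) = sgn k (i * j) • (x ⊗ₜ[k] y) := by
  simp [signTwist, superBraid_eq hx hy]

variable (𝒱 𝒲)

lemma signTwist_comp_self : signTwist 𝒱 𝒲 ∘ₗ signTwist 𝒱 𝒲 = LinearMap.id :=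
  tensor_ext 𝒱 𝒲 fun i j x hx y hy => by
    simp [signTwist_hom hx hy, smul_smul, sgn_mul_self]

/-- The automorphism `v ⊗ w ↦ (-1)^(|v||w|) v ⊗ w` of `V ⊗ W`. -/
def signTwistEquiv : V ⊗[k] W ≃ₗ[k] V ⊗[k] W :=
  LinearEquiv.ofLinearMap (signTwist 𝒱 𝒲) (signTwist 𝒱 𝒲)
    (signTwist_comp_self 𝒱 𝒲) (signTwist_comp_self 𝒱 𝒲)

end SignTwist

/-! ### Cosets H g^i, and the slices of the comultiplication of H' -/

namespace Bosonization

section Coefficients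

variable {k : Type u} {H : Type v} [Field k] [Ring H] [Algebra k H]
variable (𝒜 : ZMod 2 → Submodule k H) [GradedAlgebra 𝒜]

/-- The inclusion `a ↦ a g^i` of the coset of `g^i`. -/
def inclMul (i : ZMod 2) : H →ₗ[k] Bosonization 𝒜 :=
  LinearMap.mulRight k (genPow 𝒜 i) ∘ₗ incl 𝒜

/-- The projection `a g^e ↦ δ_{ei} a`. -/
def coord (i : ZMod 2) : Bosonization 𝒜 →ₗ[k] H :=
  if i = 0 then coordOne 𝒜 else coordGen 𝒜

/-- The map `a g^e ↦ a`. -/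
def forget : Bosonization 𝒜 →ₗ[k] H := coordOne 𝒜 + coordGen 𝒜

/-- The map `a g^e ↦ a g^e` if `|a| + e = i`, and `a g^e ↦ 0` otherwise. -/
def totalProj (i : ZMod 2) : Bosonization 𝒜 →ₗ[k] Bosonization 𝒜 :=
  ∑ e : ZMod 2, inclMul 𝒜 e ∘ₗ proj 𝒜 (i + e) ∘ₗ coord 𝒜 e

variable {𝒜}

lemma inclMul_apply (i : ZMod 2) (a : H) : inclMul 𝒜 i a = incl 𝒜 a * genPow 𝒜 i := rfl

lemma coord_inclMul (i e : ZMod 2) (a : H) :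
    coord 𝒜 i (inclMul 𝒜 e a) = if e = i then a else 0 := by
  rcases zmod2_cases i with rfl | rfl <;> rcases zmod2_cases e with rfl | rfl <;>
    simp [coord, inclMul_apply, genPow_zero, genPow_one, parity_one]

lemma forget_inclMul (e : ZMod 2) (a : H) : forget 𝒜 (inclMul 𝒜 e a) = a := by
  rcases zmod2_cases e with rfl | rfl <;>
    simp [forget, inclMul_apply, genPow_zero, genPow_one, parity_one]

lemma forget_comp_inclMul (e : ZMod 2) : forget 𝒜 ∘ₗ inclMul 𝒜 e = LinearMap.id :=
  LinearMap.ext (forget_inclMul e)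

lemma totalProj_inclMul {i : ZMod 2} {a : H} (ha : a ∈ 𝒜 i) (j e : ZMod 2) :
    totalProj 𝒜 j (inclMul 𝒜 e a) = if i + e = j then inclMul 𝒜 e a else 0 := by
  have h2 : (1 : ZMod 2) + 1 = 0 := by decide
  rw [totalProj, sum_zmod2]
  rcases zmod2_cases i with rfl | rfl <;> rcases zmod2_cases e with rfl | rfl <;>
    rcases zmod2_cases j with rfl | rfl <;> simp [coord_inclMul, proj_eq ha, h2]

/-- On the coset H g^e, fixing the total degree |a| + e = j amounts to fixing |a| = j - e, and signs
are irrelevant modulo 2. This converts the total degree, which coassociativity controls, into the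
degree in H needed for evenness of the H-coaction. -/
lemma forget_totalProj_inclMul (j e : ZMod 2) (a : H) :
    forget 𝒜 (totalProj 𝒜 j (inclMul 𝒜 e a)) = proj 𝒜 (j + e) a := by
  have h2 : (1 : ZMod 2) + 1 = 0 := by decide
  have key : forget 𝒜 ∘ₗ totalProj 𝒜 j ∘ₗ inclMul 𝒜 e = proj 𝒜 (j + e) :=
    hom_ext' 𝒜 fun i a ha => by
      simp only [LinearMap.comp_apply, totalProj_inclMul ha, proj_eq ha]
      have : ∀ i e j : ZMod 2, i + e = j ↔ i = j + e := by decide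
      simp only [this i e j]
      split_ifs <;> simp [forget_inclMul]
  exact LinearMap.congr_fun key a

/-- Together with `comul_inclMul` this is the working form of the comultiplication: the left leg of
Δ(a g^e) picks up the extra exponent |a₂|. -/
lemma psi_mul_genPow {j : ZMod 2} (e : ZMod 2) (b : H) {c : H} (hc : c ∈ 𝒜 j) :
    psi 𝒜 (b ⊗ₜ c) * (genPow 𝒜 e ⊗ₜ[k] genPow 𝒜 e) =
      inclMul 𝒜 (j + e) b ⊗ₜ[k] inclMul 𝒜 e c := by
  rw [psi_hom b hc, Algebra.TensorProduct.tmul_mul_tmul, mul_assoc, ← genPow_add, inclMul_apply,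
    inclMul_apply]

/-- The sign comes from moving g^i past b. It is the only source of signs in the tensor product of
H'-comodules. -/
lemma inclMul_mul_inclMul {j : ZMod 2} (i e : ZMod 2) (a : H) {b : H} (hb : b ∈ 𝒜 j) :
    inclMul 𝒜 i a * inclMul 𝒜 e b = sgn k (j * i) • inclMul 𝒜 (i + e) (a * b) := by
  rw [inclMul_apply, inclMul_apply, inclMul_apply, mul_assoc, ← mul_assoc (genPow 𝒜 i),
    genPow_mul_incl i hb, smul_mul_assoc, mul_smul_comm, incl_mul, genPow_add]
  simp only [mul_assoc]

variable [Coalgebra k H] [HopfSuperalgebra 𝒜]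

lemma comul_inclMul (i : ZMod 2) (a : H) : Coalgebra.comul (R := k) (inclMul 𝒜 i a) =
    psi 𝒜 (Coalgebra.comul a) * (genPow 𝒜 i ⊗ₜ genPow 𝒜 i) :=
  comul'_eq a i

lemma counit_inclMul (i : ZMod 2) (a : H) :
    Coalgebra.counit (R := k) (inclMul 𝒜 i a) = Coalgebra.counit (R := k) a :=
  counit'_eq a i

/-- The modified comultiplication differs from that of H only in the powers of g attached to the two
legs, so erasing these powers is a map of coalgebras. It is not multiplicative, which is why tensor
products need the sign twist. -/
lemma map_forget_comul (x : Bosonization 𝒜) :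
    TensorProduct.map (forget 𝒜) (forget 𝒜) (Coalgebra.comul (R := k) x) =
      Coalgebra.comul (R := k) (forget 𝒜 x) := by
  have key : TensorProduct.map (forget 𝒜) (forget 𝒜) ∘ₗ Coalgebra.comul (R := k) =
      Coalgebra.comul (R := k) ∘ₗ forget 𝒜 := hom_ext fun i a ha e => by
    change TensorProduct.map (forget 𝒜) (forget 𝒜) (Coalgebra.comul (R := k) (inclMul 𝒜 e a)) =
      Coalgebra.comul (R := k) (forget 𝒜 (inclMul 𝒜 e a))
    rw [forget_inclMul, comul_inclMul]
    -- The identity holds for every tensor b ⊗ c in place of the coproduct of a, so nothing about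
    -- that coproduct is needed.
    have h : TensorProduct.map (forget 𝒜) (forget 𝒜) ∘ₗ
        LinearMap.mulRight k (genPow 𝒜 e ⊗ₜ[k] genPow 𝒜 e) ∘ₗ psi 𝒜 = LinearMap.id :=
      tensor_ext 𝒜 𝒜 fun p q b hb c hc => by
        simp only [LinearMap.comp_apply, LinearMap.mulRight_apply, psi_mul_genPow _ b hc,
          TensorProduct.map_tmul, forget_inclMul, LinearMap.id_apply]
    exact LinearMap.congr_fun h _
  exact LinearMap.congr_fun key x

lemma counit_forget (x : Bosonization 𝒜) :
    Coalgebra.counit (R := k) (forget 𝒜 x) = Coalgebra.counit (R := k) x := by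
  simp [forget, counit_def, counit']

variable (𝒜) in
/-- The functional `a g^e ↦ δ_{ei} ε(a)`. -/
def coordCounit (i : ZMod 2) : Bosonization 𝒜 →ₗ[k] k := Coalgebra.counit ∘ₗ coord 𝒜 i

lemma coordCounit_inclMul (i e : ZMod 2) (a : H) :
    coordCounit 𝒜 i (inclMul 𝒜 e a) = if e = i then Coalgebra.counit (R := k) a else 0 := by
  rw [coordCounit, LinearMap.comp_apply, coord_inclMul]
  split_ifs <;> simp

/-- The two functionals split the counit; this will say that the two homogeneous components of a
vector add up to it. -/
lemma sum_coordCounit : coordCounit 𝒜 0 + coordCounit 𝒜 1 = Coalgebra.counit (R := k) := by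
  ext x
  simp [coordCounit, coord, counit_def, counit']

/-- In a₁ g^(|a₂|+e) ⊗ a₂ g^e the functional sees ε(a₂), so only even a₂ survive and the left
exponent remains e. The slice is therefore the projection onto the coset H g^i. -/
lemma rid_coordCounit_comul (i : ZMod 2) (x : Bosonization 𝒜) :
    TensorProduct.rid k _ ((coordCounit 𝒜 i).lTensor _ (Coalgebra.comul (R := k) x)) =
      inclMul 𝒜 i (coord 𝒜 i x) := by
  have key : (TensorProduct.rid k (Bosonization 𝒜)).toLinearMap ∘ₗ
      (coordCounit 𝒜 i).lTensor _ ∘ₗ Coalgebra.comul = inclMul 𝒜 i ∘ₗ coord 𝒜 i :=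
    hom_ext fun p a ha e => by
      change TensorProduct.rid k _ ((coordCounit 𝒜 i).lTensor _
        (Coalgebra.comul (R := k) (inclMul 𝒜 e a))) = inclMul 𝒜 i (coord 𝒜 i (inclMul 𝒜 e a))
      rw [coord_inclMul, comul_inclMul]
      have h : (TensorProduct.rid k (Bosonization 𝒜)).toLinearMap ∘ₗ
          (coordCounit 𝒜 i).lTensor _ ∘ₗ
            LinearMap.mulRight k (genPow 𝒜 e ⊗ₜ[k] genPow 𝒜 e) ∘ₗ psi 𝒜 =
          (if e = i then (1 : k) else 0) • inclMul 𝒜 e ∘ₗ (TensorProduct.rid k H).toLinearMap ∘ₗ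
            (Coalgebra.counit (R := k)).lTensor H :=
        tensor_ext 𝒜 𝒜 fun p q b hb c hc => by
          simp only [LinearMap.comp_apply, LinearMap.mulRight_apply, psi_mul_genPow _ b hc,
            LinearMap.lTensor_tmul, coordCounit_inclMul, LinearEquiv.coe_coe,
            TensorProduct.rid_tmul, LinearMap.smul_apply, map_smul]
          -- The exponents q + e and e agree when c is even; when c is odd, ε(c) = 0 makes both
          -- sides vanish.
          by_cases hq : q = 0
          · subst hq
            rw [zero_add]; split_ifs <;> simp
          · rw [counit_eq hc hq]; simp
      have h' := LinearMap.congr_fun h (Coalgebra.comul (R := k) a)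
      simp only [LinearMap.comp_apply, LinearMap.smul_apply, Coalgebra.lTensor_counit_comul,
        LinearEquiv.coe_coe, TensorProduct.rid_tmul, one_smul] at h'
      refine h'.trans ?_
      split_ifs with hei
      · subst hei; simp
      · simp
  exact LinearMap.congr_fun key x

/-- Slicing the left leg tests the exponent |a₂| + e and keeps only even a₁. For homogeneous a this
forces |a₂| = |a|, so the condition becomes |a| + e = i: the total degree appears instead of the
coset. -/
lemma lid_coordCounit_comul (i : ZMod 2) (x : Bosonization 𝒜) :
    TensorProduct.lid k _ ((coordCounit 𝒜 i).rTensor _ (Coalgebra.comul (R := k) x)) =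
      totalProj 𝒜 i x := by
  have key : (TensorProduct.lid k (Bosonization 𝒜)).toLinearMap ∘ₗ
      (coordCounit 𝒜 i).rTensor _ ∘ₗ Coalgebra.comul = totalProj 𝒜 i :=
    hom_ext fun p a ha e => by
      change TensorProduct.lid k _ ((coordCounit 𝒜 i).rTensor _
        (Coalgebra.comul (R := k) (inclMul 𝒜 e a))) = totalProj 𝒜 i (inclMul 𝒜 e a)
      rw [totalProj_inclMul ha, comul_inclMul]
      -- Unlike for the other slice, the tensor must be homogeneous of degree p: it is r = 0
      -- together with r + q = p that identifies the exponent q + e with p + e.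
      have h := eqOn_tensor (f := (TensorProduct.lid k (Bosonization 𝒜)).toLinearMap ∘ₗ
          (coordCounit 𝒜 i).rTensor _ ∘ₗ
            LinearMap.mulRight k (genPow 𝒜 e ⊗ₜ[k] genPow 𝒜 e) ∘ₗ psi 𝒜)
          (g := (if p + e = i then (1 : k) else 0) • inclMul 𝒜 e ∘ₗ
            (TensorProduct.lid k H).toLinearMap ∘ₗ (Coalgebra.counit (R := k)).rTensor H)
        (fun r q hrq b hb c hc => by
          simp only [LinearMap.comp_apply, LinearMap.mulRight_apply, psi_mul_genPow _ b hc,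
            LinearMap.rTensor_tmul, coordCounit_inclMul, LinearEquiv.coe_coe,
            TensorProduct.lid_tmul, LinearMap.smul_apply, map_smul]
          by_cases hr : r = 0
          · subst hr hrq
            rw [zero_add]; split_ifs <;> simp
          · rw [counit_eq hb hr]; simp) (HopfSuperalgebra.comul_mem p a ha)
      simp only [LinearMap.comp_apply, LinearMap.smul_apply, Coalgebra.rTensor_counit_comul,
        LinearEquiv.coe_coe, TensorProduct.lid_tmul, one_smul] at h
      refine h.trans ?_
      split_ifs <;> simp
  exact LinearMap.congr_fun key x

end Coefficients

end Bosonization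

open Bosonization

/-! ### Slicing iterated coactions by functionals -/

section TensorMaps

variable {k : Type u} [Field k]
variable {V V' M N : Type*} [AddCommGroup V] [Module k V] [AddCommGroup V'] [Module k V']
variable [AddCommGroup M] [Module k M] [AddCommGroup N] [Module k N]

lemma rTensor_lTensor_apply (f : V →ₗ[k] V') (g : M →ₗ[k] N) (t : V ⊗[k] M) :
    f.rTensor N (g.lTensor V t) = g.lTensor V' (f.rTensor M t) := by
  rw [← LinearMap.comp_apply, ← LinearMap.comp_apply, LinearMap.rTensor_comp_lTensor,
    LinearMap.lTensor_comp_rTensor]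

/-- Evaluating a functional on the coefficients of `v` and then applying `ρ`. -/
lemma map_rid_lTensor (ρ : V →ₗ[k] V ⊗[k] M) (χ : N →ₗ[k] k) (t : V ⊗[k] N) :
    ρ (TensorProduct.rid k V (χ.lTensor V t)) =
      ((TensorProduct.rid k M).toLinearMap ∘ₗ χ.lTensor M).lTensor V
        (TensorProduct.assoc k V M N (ρ.rTensor N t)) := by
  induction t using TensorProduct.induction_on with
  | zero => simp
  | add x y hx hy => simp only [map_add, hx, hy]
  | tmul v b =>
    simp only [LinearMap.lTensor_tmul, TensorProduct.rid_tmul, map_smul, LinearMap.rTensor_tmul]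
    generalize ρ v = s
    induction s using TensorProduct.induction_on with
    | zero => simp
    | add x y hx hy => simp only [map_add, smul_add, TensorProduct.add_tmul, hx, hy]
    | tmul y c => simp

/-- Evaluating a functional on the middle factor of an iterated coaction. -/
lemma rTensor_rid_lTensor (ρ : V →ₗ[k] V' ⊗[k] M) (χ : M →ₗ[k] k) (t : V ⊗[k] N) :
    ((TensorProduct.rid k V').toLinearMap ∘ₗ χ.lTensor V' ∘ₗ ρ).rTensor N t =
      ((TensorProduct.lid k N).toLinearMap ∘ₗ χ.rTensor N).lTensor V'
        (TensorProduct.assoc k V' M N (ρ.rTensor N t)) := by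
  induction t using TensorProduct.induction_on with
  | zero => simp
  | add x y hx hy => simp only [map_add, hx, hy]
  | tmul v b =>
    simp only [LinearMap.rTensor_tmul, LinearMap.comp_apply]
    generalize ρ v = s
    induction s using TensorProduct.induction_on with
    | zero => simp
    | add x y hx hy => simp only [map_add, TensorProduct.add_tmul, hx, hy]
    | tmul y c => simp [TensorProduct.smul_tmul]

end TensorMaps

/-! ### From an even coaction of H to a coaction of H' -/

section BosonCoact

variable {k : Type u} {H : Type v} [Field k] [Ring H] [Algebra k H]
variable (𝒜 : ZMod 2 → Submodule k H) [GradedAlgebra 𝒜]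
variable {V : Type*} [AddCommGroup V] [Module k V] (𝒱 : ZMod 2 → Submodule k V)
variable {W : Type*} [AddCommGroup W] [Module k W] (𝒲 : ZMod 2 → Submodule k W)
variable [DirectSum.Decomposition 𝒱] [DirectSum.Decomposition 𝒲]

/-- The coaction `v ↦ v₀ ⊗ v₁ g^|v|` of `k[ℤ/2] ⋉ H` attached to an even coaction of `H`. -/
def bosonCoact (ρ : V →ₗ[k] V ⊗[k] H) : V →ₗ[k] V ⊗[k] Bosonization 𝒜 :=
  ∑ i : ZMod 2, (inclMul 𝒜 i).lTensor V ∘ₗ ρ ∘ₗ proj 𝒱 i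

variable {𝒜 𝒱 𝒲}

lemma bosonCoact_hom (ρ : V →ₗ[k] V ⊗[k] H) {i : ZMod 2} {v : V} (hv : v ∈ 𝒱 i) :
    bosonCoact 𝒜 𝒱 ρ v = (inclMul 𝒜 i).lTensor V (ρ v) := by
  rw [bosonCoact, sum_zmod2]
  rcases zmod2_cases i with rfl | rfl <;> simp [proj_eq hv]

lemma forget_bosonCoact (ρ : V →ₗ[k] V ⊗[k] H) (v : V) :
    (forget 𝒜).lTensor V (bosonCoact 𝒜 𝒱 ρ v) = ρ v := by
  have key : (forget 𝒜).lTensor V ∘ₗ bosonCoact 𝒜 𝒱 ρ = ρ := hom_ext' 𝒱 fun i v hv => by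
    rw [LinearMap.comp_apply, bosonCoact_hom ρ hv, ← LinearMap.lTensor_comp_apply,
      forget_comp_inclMul, LinearMap.lTensor_id, LinearMap.id_apply]
  exact LinearMap.congr_fun key v

/-- Evenness of f is what makes v and f v receive the same power of g. -/
lemma bosonCoact_naturality {ρV : V →ₗ[k] V ⊗[k] H} {ρW : W →ₗ[k] W ⊗[k] H} {f : V →ₗ[k] W}
    (hf : ∀ i, ∀ x ∈ 𝒱 i, f x ∈ 𝒲 i) (h : f.rTensor H ∘ₗ ρV = ρW ∘ₗ f) :
    f.rTensor (Bosonization 𝒜) ∘ₗ bosonCoact 𝒜 𝒱 ρV = bosonCoact 𝒜 𝒲 ρW ∘ₗ f :=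
  hom_ext' 𝒱 fun i v hv => by
    have h' := LinearMap.congr_fun h v
    simp only [LinearMap.comp_apply] at h' ⊢
    rw [bosonCoact_hom ρV hv, bosonCoact_hom ρW (hf i v hv), rTensor_lTensor_apply, h']

/-- The sign twist intertwines the two coactions on a tensor product. -/
lemma signTwist_bosonCoact {ρV : V →ₗ[k] V ⊗[k] H} {ρW : W →ₗ[k] W ⊗[k] H}
    (hV : ∀ i, ∀ v ∈ 𝒱 i, ρV v ∈ tensorGrading 𝒱 𝒜 i)
    (hW : ∀ i, ∀ w ∈ 𝒲 i, ρW w ∈ tensorGrading 𝒲 𝒜 i) :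
    (signTwist 𝒱 𝒲).rTensor (Bosonization 𝒜) ∘ₗ
        tensorCoact (bosonCoact 𝒜 𝒱 ρV) (bosonCoact 𝒜 𝒲 ρW) =
      bosonCoact 𝒜 (tensorGrading 𝒱 𝒲) (superTensorCoact 𝒜 𝒲 ρV ρW) ∘ₗ signTwist 𝒱 𝒲 := by
  -- By evenness of the coactions, only the degrees of ρV v and ρW w matter. They are replaced by
  -- arbitrary homogeneous tensors x and y, which can then be decomposed into v ⊗ a and w ⊗ b. The
  -- factor `sgn k (i * j)` is the twist applied before the super coaction.
  have key : ∀ i j, ∀ x ∈ tensorGrading 𝒱 𝒜 i, ∀ y ∈ tensorGrading 𝒲 𝒜 j,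
      (signTwist 𝒱 𝒲).rTensor (Bosonization 𝒜) (star k (Bosonization 𝒜) V W
        ((inclMul 𝒜 i).lTensor V x ⊗ₜ (inclMul 𝒜 j).lTensor W y)) =
      sgn k (i * j) • (inclMul 𝒜 (i + j)).lTensor (V ⊗[k] W) (superStar 𝒜 𝒲 (x ⊗ₜ y)) := by
    intro i j x hx y hy
    refine eqOn_tensor (f := (signTwist 𝒱 𝒲).rTensor (Bosonization 𝒜) ∘ₗ
        star k (Bosonization 𝒜) V W ∘ₗ
          (TensorProduct.mk k _ _).flip ((inclMul 𝒜 j).lTensor W y) ∘ₗ (inclMul 𝒜 i).lTensor V)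
      (g := sgn k (i * j) • (inclMul 𝒜 (i + j)).lTensor (V ⊗[k] W) ∘ₗ superStar 𝒜 𝒲 ∘ₗ
          (TensorProduct.mk k _ _).flip y) (fun p q hpq v hv a ha => ?_) hx
    refine eqOn_tensor (f := (signTwist 𝒱 𝒲).rTensor (Bosonization 𝒜) ∘ₗ
        star k (Bosonization 𝒜) V W ∘ₗ
          TensorProduct.mk k _ _ ((inclMul 𝒜 i).lTensor V (v ⊗ₜ a)) ∘ₗ (inclMul 𝒜 j).lTensor W)
      (g := sgn k (i * j) • (inclMul 𝒜 (i + j)).lTensor (V ⊗[k] W) ∘ₗ superStar 𝒜 𝒲 ∘ₗ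
          TensorProduct.mk k _ _ (v ⊗ₜ a)) (fun r s hrs w hw b hb => ?_) hy
    simp only [LinearMap.comp_apply, LinearMap.smul_apply, TensorProduct.mk_apply,
      LinearMap.lTensor_tmul, star_tmul, LinearMap.rTensor_tmul, signTwist_hom hv hw,
      superStar_hom v b ha hw, inclMul_mul_inclMul i j a hb, map_smul, smul_smul,
      TensorProduct.tmul_smul, ← TensorProduct.smul_tmul', ← sgn_add]
    -- With i = p + q and j = r + s, where p, q, r, s are the degrees of v, a, w, b, what remains is
    -- si + pr = ij + qr modulo 2. Here si comes from moving g^i past b, qr from the super tensor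
    -- product, and pr and ij from the twist on the two sides.
    congr 2
    subst hpq hrs
    clear * -
    revert p q r s
    decide
  refine tensor_ext 𝒱 𝒲 fun i j v hv w hw => ?_
  simp only [LinearMap.comp_apply, tensorCoact, TensorProduct.map_tmul, bosonCoact_hom ρV hv,
    bosonCoact_hom ρW hw, signTwist_hom hv hw, map_smul,
    bosonCoact_hom (superTensorCoact 𝒜 𝒲 ρV ρW) (tmul_mem rfl hv hw)]
  exact key i j _ (hV i v hv) _ (hW j w hw)

variable [Coalgebra k H] [HopfSuperalgebra 𝒜]

/-- Iterating the coaction attaches g^|v₀| to the middle factor, while the comultiplication of H'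
attaches g^(|v₂|+|v|) to it. Evenness gives |v| = |v₀| + |v₂|, where v₀ ⊗ v₂ is the outer coaction,
so these powers coincide. -/
lemma bosonCoact_coassoc {ρ : V →ₗ[k] V ⊗[k] H}
    (hρ : ∀ i, ∀ v ∈ 𝒱 i, ρ v ∈ tensorGrading 𝒱 𝒜 i)
    (h : (TensorProduct.assoc k V H H).toLinearMap ∘ₗ ρ.rTensor H ∘ₗ ρ =
      LinearMap.lTensor V Coalgebra.comul ∘ₗ ρ) :
    (TensorProduct.assoc k V (Bosonization 𝒜) (Bosonization 𝒜)).toLinearMap ∘ₗ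
        (bosonCoact 𝒜 𝒱 ρ).rTensor (Bosonization 𝒜) ∘ₗ bosonCoact 𝒜 𝒱 ρ =
      LinearMap.lTensor V Coalgebra.comul ∘ₗ bosonCoact 𝒜 𝒱 ρ := by
  refine hom_ext' 𝒱 fun i v hv => ?_
  have hv' := LinearMap.congr_fun h v
  simp only [LinearMap.comp_apply, LinearEquiv.coe_coe] at hv' ⊢
  have hcomul : Coalgebra.comul ∘ₗ inclMul 𝒜 i =
      (LinearMap.mulRight k (genPow 𝒜 i ⊗ₜ[k] genPow 𝒜 i) ∘ₗ psi 𝒜) ∘ₗ Coalgebra.comul :=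
    LinearMap.ext (comul_inclMul i)
  rw [bosonCoact_hom ρ hv, ← LinearMap.lTensor_comp_apply, hcomul, LinearMap.lTensor_comp_apply,
    ← hv']
  -- Once coassociativity of ρ has been used, both sides are linear functions of the degree i tensor
  -- ρ v, so they may be compared on x ⊗ a with |x| + |a| = i.
  refine eqOn_tensor (f := (TensorProduct.assoc k V (Bosonization 𝒜) (Bosonization 𝒜)).toLinearMap ∘ₗ
      (bosonCoact 𝒜 𝒱 ρ).rTensor (Bosonization 𝒜) ∘ₗ (inclMul 𝒜 i).lTensor V)
    (g := LinearMap.lTensor V (LinearMap.mulRight k (genPow 𝒜 i ⊗ₜ[k] genPow 𝒜 i) ∘ₗ psi 𝒜) ∘ₗ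
      (TensorProduct.assoc k V H H).toLinearMap ∘ₗ ρ.rTensor H)
    (fun p q hpq x hx a ha => ?_) (hρ i v hv)
  simp only [LinearMap.comp_apply, LinearMap.lTensor_tmul, LinearMap.rTensor_tmul,
    bosonCoact_hom ρ hx, LinearEquiv.coe_coe]
  have hp : q + i = p := by
    subst hpq; clear * -; revert p q; decide
  generalize ρ x = s
  induction s using TensorProduct.induction_on with
  | zero => simp
  | add x y hx hy => simp only [map_add, TensorProduct.add_tmul, hx, hy]
  | tmul y b =>
    simp only [LinearMap.lTensor_tmul, TensorProduct.assoc_tmul, LinearMap.comp_apply,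
      LinearMap.mulRight_apply, psi_mul_genPow i b ha, hp]

lemma bosonCoact_counit {ρ : V →ₗ[k] V ⊗[k] H}
    (h : LinearMap.lTensor V Coalgebra.counit ∘ₗ ρ = (TensorProduct.mk k V k).flip 1) :
    LinearMap.lTensor V Coalgebra.counit ∘ₗ bosonCoact 𝒜 𝒱 ρ = (TensorProduct.mk k V k).flip 1 := by
  rw [← h]
  refine hom_ext' 𝒱 fun i v hv => ?_
  rw [LinearMap.comp_apply, LinearMap.comp_apply, bosonCoact_hom ρ hv,
    ← LinearMap.lTensor_comp_apply]
  congr 2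
  exact LinearMap.ext (counit_inclMul i)

/-- The grading can be recovered from the coaction of `k[ℤ/2] ⋉ H`. -/
lemma coordCounit_bosonCoact {ρ : V →ₗ[k] V ⊗[k] H}
    (h : LinearMap.lTensor V Coalgebra.counit ∘ₗ ρ = (TensorProduct.mk k V k).flip 1)
    (i : ZMod 2) (v : V) :
    TensorProduct.rid k V ((coordCounit 𝒜 i).lTensor V (bosonCoact 𝒜 𝒱 ρ v)) = proj 𝒱 i v := by
  have key : (TensorProduct.rid k V).toLinearMap ∘ₗ (coordCounit 𝒜 i).lTensor V ∘ₗ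
      bosonCoact 𝒜 𝒱 ρ = proj 𝒱 i := hom_ext' 𝒱 fun e v hv => by
    have hc : coordCounit 𝒜 i ∘ₗ inclMul 𝒜 e =
        (if e = i then (1 : k) else 0) • Coalgebra.counit (R := k) := by
      ext a
      rw [LinearMap.comp_apply, coordCounit_inclMul, LinearMap.smul_apply]
      split_ifs <;> simp
    have hv' := LinearMap.congr_fun h v
    simp only [LinearMap.comp_apply, LinearMap.flip_apply, TensorProduct.mk_apply] at hv' ⊢
    rw [bosonCoact_hom ρ hv, ← LinearMap.lTensor_comp_apply, hc, LinearMap.lTensor_smul,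
      LinearMap.smul_apply, hv', proj_eq hv]
    split_ifs <;> simp
  exact LinearMap.congr_fun key v

/-- A map compatible with the coactions of `k[ℤ/2] ⋉ H` is even. -/
lemma map_mem_of_comm_bosonCoact {ρV : V →ₗ[k] V ⊗[k] H} {ρW : W →ₗ[k] W ⊗[k] H}
    (hV : LinearMap.lTensor V Coalgebra.counit ∘ₗ ρV = (TensorProduct.mk k V k).flip 1)
    (hW : LinearMap.lTensor W Coalgebra.counit ∘ₗ ρW = (TensorProduct.mk k W k).flip 1)
    {f : V →ₗ[k] W}
    (hf : f.rTensor (Bosonization 𝒜) ∘ₗ bosonCoact 𝒜 𝒱 ρV = bosonCoact 𝒜 𝒲 ρW ∘ₗ f)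
    {i : ZMod 2} {x : V} (hx : x ∈ 𝒱 i) : f x ∈ 𝒲 i := by
  have h := coordCounit_bosonCoact (𝒜 := 𝒜) (𝒱 := 𝒲) hW i (f x)
  have hr : ∀ t : V ⊗[k] k, TensorProduct.rid k W (f.rTensor k t) =
      f (TensorProduct.rid k V t) := fun t => by
    induction t using TensorProduct.induction_on with
    | zero => simp
    | add x y hx hy => simp only [map_add, hx, hy]
    | tmul x c => simp
  have hfx := LinearMap.congr_fun hf x
  simp only [LinearMap.comp_apply] at hfx
  -- Projection onto degree i is the same slice of the coaction on V and on W, so f commutes with it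
  -- and f x equals its own degree i component.
  rw [← hfx, ← rTensor_lTensor_apply, hr, coordCounit_bosonCoact hV, proj_same hx] at h
  rw [h]
  exact proj_mem 𝒲 i _

/-- A map compatible with the coactions of `k[ℤ/2] ⋉ H` is compatible with those of `H`. -/
lemma comm_of_comm_bosonCoact {ρV : V →ₗ[k] V ⊗[k] H} {ρW : W →ₗ[k] W ⊗[k] H} {f : V →ₗ[k] W}
    (hf : f.rTensor (Bosonization 𝒜) ∘ₗ bosonCoact 𝒜 𝒱 ρV = bosonCoact 𝒜 𝒲 ρW ∘ₗ f) :
    f.rTensor H ∘ₗ ρV = ρW ∘ₗ f := by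
  ext x
  have hfx := LinearMap.congr_fun hf x
  simp only [LinearMap.comp_apply] at hfx ⊢
  -- Erasing powers of g touches only the coefficients, hence commutes with applying f to the
  -- vectors.
  rw [← forget_bosonCoact (𝒜 := 𝒜) (𝒱 := 𝒲) ρW, ← hfx, ← rTensor_lTensor_apply,
    forget_bosonCoact]

end BosonCoact

/-! ### From a comodule over H' back to a supercomodule over H -/

namespace Corep

variable {k : Type u} {H : Type v} [Field k] [Ring H] [Algebra k H] [Coalgebra k H]
variable {𝒜 : ZMod 2 → Submodule k H} [GradedAlgebra 𝒜] [HopfSuperalgebra 𝒜]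
variable (W : Corep k (Bosonization 𝒜))

/-- The projection of a comodule over `k[ℤ/2] ⋉ H` onto the part on which `ℤ/2` coacts
through `g^i`. -/
noncomputable def degreeProj (i : ZMod 2) : W.carrier →ₗ[k] W.carrier :=
  (TensorProduct.rid k W.carrier).toLinearMap ∘ₗ (coordCounit 𝒜 i).lTensor W.carrier ∘ₗ W.coact

lemma coassoc_apply (w : W.carrier) :
    TensorProduct.assoc k W.carrier (Bosonization 𝒜) (Bosonization 𝒜)
      (W.coact.rTensor (Bosonization 𝒜) (W.coact w)) =
    LinearMap.lTensor W.carrier Coalgebra.comul (W.coact w) :=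
  LinearMap.congr_fun W.coassoc w

/-- By coassociativity, coacting on a slice of the coaction is slicing the right leg of the
comultiplication, computed in `rid_coordCounit_comul`. Consequently homogeneous vectors of degree i
have all coefficients in H g^i. -/
lemma coact_degreeProj (i : ZMod 2) (w : W.carrier) :
    W.coact (W.degreeProj i w) =
      (inclMul 𝒜 i ∘ₗ coord 𝒜 i).lTensor W.carrier (W.coact w) := by
  refine (map_rid_lTensor W.coact (coordCounit 𝒜 i) (W.coact w)).trans ?_
  rw [coassoc_apply, ← LinearMap.lTensor_comp_apply]
  congr 2
  exact LinearMap.ext (rid_coordCounit_comul i)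

/-- Slicing the inner coaction is, by coassociativity, slicing the left leg of the comultiplication,
computed in `lid_coordCounit_comul`. The degree of a vector is thus read off from the coefficient a
g^e next to it, as |a| + e. -/
lemma degreeProj_rTensor_coact (j : ZMod 2) (w : W.carrier) :
    (W.degreeProj j).rTensor (Bosonization 𝒜) (W.coact w) =
      (totalProj 𝒜 j).lTensor W.carrier (W.coact w) := by
  refine (rTensor_rid_lTensor W.coact (coordCounit 𝒜 j) (W.coact w)).trans ?_
  rw [coassoc_apply, ← LinearMap.lTensor_comp_apply]
  congr 2
  exact LinearMap.ext (lid_coordCounit_comul j)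

/-- After the first projection all coefficients lie in H g^i, where `coordCounit 𝒜 j` is zero unless
j = i. -/
lemma degreeProj_degreeProj (i j : ZMod 2) (w : W.carrier) :
    W.degreeProj j (W.degreeProj i w) = if i = j then W.degreeProj i w else 0 := by
  have hc : coordCounit 𝒜 j ∘ₗ inclMul 𝒜 i ∘ₗ coord 𝒜 i =
      (if i = j then (1 : k) else 0) • coordCounit 𝒜 i := by
    ext x
    rw [LinearMap.comp_apply, LinearMap.comp_apply, coordCounit_inclMul, LinearMap.smul_apply]
    split_ifs <;> simp [coordCounit]
  have h : W.degreeProj j (W.degreeProj i w) = TensorProduct.rid k W.carrier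
      ((coordCounit 𝒜 j).lTensor W.carrier (W.coact (W.degreeProj i w))) := rfl
  rw [h, coact_degreeProj, ← LinearMap.lTensor_comp_apply, hc, LinearMap.lTensor_smul,
    LinearMap.smul_apply, map_smul]
  split_ifs
  · rw [one_smul]; rfl
  · rw [zero_smul]

lemma degreeProj_add (w : W.carrier) : W.degreeProj 0 w + W.degreeProj 1 w = w := by
  have h := LinearMap.congr_fun W.counit w
  rw [LinearMap.comp_apply, ← sum_coordCounit, LinearMap.lTensor_add, LinearMap.add_apply] at h
  have h' := congrArg (TensorProduct.rid k W.carrier) h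
  rw [map_add, LinearMap.flip_apply, TensorProduct.mk_apply, TensorProduct.rid_tmul,
    one_smul] at h'
  exact h'

/-- The grading defined by the coaction of `ℤ/2`. -/
noncomputable def degreeGrading (i : ZMod 2) : Submodule k W.carrier :=
  LinearMap.range (W.degreeProj i)

lemma degreeProj_eq {i : ZMod 2} {w : W.carrier} (hw : w ∈ W.degreeGrading i) (j : ZMod 2) :
    W.degreeProj j w = if i = j then w else 0 := by
  obtain ⟨w, rfl⟩ := hw
  exact W.degreeProj_degreeProj i j w

noncomputable instance : DirectSum.Decomposition W.degreeGrading :=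
  decompositionOfProj W.degreeGrading W.degreeProj (fun i w => ⟨w, rfl⟩)
    (fun _ j _ hw => W.degreeProj_eq hw j) W.degreeProj_add

lemma coact_of_mem {i : ZMod 2} {w : W.carrier} (hw : w ∈ W.degreeGrading i) :
    W.coact w = (inclMul 𝒜 i ∘ₗ coord 𝒜 i).lTensor W.carrier (W.coact w) := by
  rw [← coact_degreeProj, degreeProj_eq W hw, if_pos rfl]

/-- The coaction of `H` underlying a coaction of `k[ℤ/2] ⋉ H`. -/
noncomputable def forgetCoact : W.carrier →ₗ[k] W.carrier ⊗[k] H :=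
  (forget 𝒜).lTensor W.carrier ∘ₗ W.coact

/-- For w of degree i the coefficients are a g^i, and the vector paired with one of them has degree
j = |a| + i. Then j + |a| = i, which is evenness. -/
lemma forgetCoact_mem {i : ZMod 2} {w : W.carrier} (hw : w ∈ W.degreeGrading i) :
    W.forgetCoact w ∈ tensorGrading W.degreeGrading 𝒜 i := by
  -- The component with vector of degree j has its H-coefficients in degree j + i.
  have hj : ∀ j, (W.degreeProj j).rTensor H (W.forgetCoact w) =
      (proj 𝒜 (j + i) ∘ₗ coord 𝒜 i).lTensor W.carrier (W.coact w) := by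
    intro j
    have hc : proj 𝒜 (j + i) ∘ₗ coord 𝒜 i =
        (forget 𝒜 ∘ₗ totalProj 𝒜 j) ∘ₗ (inclMul 𝒜 i ∘ₗ coord 𝒜 i) :=
      LinearMap.ext fun x => (forget_totalProj_inclMul j i (coord 𝒜 i x)).symm
    rw [hc, LinearMap.lTensor_comp_apply, ← coact_of_mem W hw, LinearMap.lTensor_comp_apply,
      ← degreeProj_rTensor_coact, forgetCoact, LinearMap.comp_apply, rTensor_lTensor_apply]
  have hmem : ∀ (j : ZMod 2) (t : W.carrier ⊗[k] Bosonization 𝒜), (W.degreeProj j).rTensor H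
      ((proj 𝒜 (j + i) ∘ₗ coord 𝒜 i).lTensor W.carrier t) ∈
        tensorGrading W.degreeGrading 𝒜 i := by
    intro j t
    induction t using TensorProduct.induction_on with
    | zero => simp
    | add x y hx hy => simp only [map_add]; exact Submodule.add_mem _ hx hy
    | tmul x b =>
      refine tmul_mem (i := j) (j := j + i) ?_ ⟨x, rfl⟩ (proj_mem 𝒜 _ _)
      clear * -
      revert i j; decide
  -- Projecting twice allows the inner projection to be traded, through `hj`, for the degree
  -- condition on the coefficients while the outer one still places the vectors in degree j.
  have hid : ∀ j, (W.degreeProj j).rTensor H ((W.degreeProj j).rTensor H (W.forgetCoact w)) =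
      (W.degreeProj j).rTensor H (W.forgetCoact w) := by
    intro j
    rw [← LinearMap.rTensor_comp_apply]
    congr 2
    exact LinearMap.ext fun x => (W.degreeProj_degreeProj j j x).trans (if_pos rfl)
  have hsum : W.forgetCoact w = (W.degreeProj 0).rTensor H (W.forgetCoact w) +
      (W.degreeProj 1).rTensor H (W.forgetCoact w) := by
    rw [← LinearMap.add_apply, ← LinearMap.rTensor_add,
      show W.degreeProj 0 + W.degreeProj 1 = LinearMap.id from LinearMap.ext W.degreeProj_add,
      LinearMap.rTensor_id, LinearMap.id_apply]
  rw [hsum, ← hid 0, ← hid 1, hj, hj]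
  exact Submodule.add_mem _ (hmem 0 _) (hmem 1 _)

/-- On degree i all coefficients lie in H g^i, so erasing the power of g and appending g^i again
changes nothing. -/
lemma bosonCoact_forgetCoact : bosonCoact 𝒜 W.degreeGrading W.forgetCoact = W.coact :=
  hom_ext' W.degreeGrading fun i w hw => by
    have hc : (inclMul 𝒜 i ∘ₗ forget 𝒜) ∘ₗ inclMul 𝒜 i ∘ₗ coord 𝒜 i =
        inclMul 𝒜 i ∘ₗ coord 𝒜 i :=
      LinearMap.ext fun x => by simp only [LinearMap.comp_apply, forget_inclMul]
    rw [bosonCoact_hom W.forgetCoact hw, forgetCoact, LinearMap.comp_apply, W.coact_of_mem hw,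
      ← LinearMap.lTensor_comp_apply, ← LinearMap.lTensor_comp_apply, hc]

/-- The supercomodule over `H` underlying a comodule over `k[ℤ/2] ⋉ H`. -/
noncomputable def toSuperCorep : SuperCorep 𝒜 where
  carrier := W.carrier
  grading := W.degreeGrading
  coact := W.forgetCoact
  coact_mem := fun _ _ hw => W.forgetCoact_mem hw
  coassoc := by
    -- Powers of g may be erased after each coaction or all at the end; coassociativity then
    -- descends from H' because erasing is compatible with the comultiplications.
    have key : ∀ t : W.carrier ⊗[k] Bosonization 𝒜,
        TensorProduct.assoc k W.carrier H H
          (W.forgetCoact.rTensor H ((forget 𝒜).lTensor W.carrier t)) =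
        (TensorProduct.map (forget 𝒜) (forget 𝒜)).lTensor W.carrier
          (TensorProduct.assoc k W.carrier (Bosonization 𝒜) (Bosonization 𝒜)
            (W.coact.rTensor (Bosonization 𝒜) t)) := by
      intro t
      induction t using TensorProduct.induction_on with
      | zero => simp
      | add x y hx hy => simp only [map_add, hx, hy]
      | tmul w b =>
        simp only [LinearMap.lTensor_tmul, LinearMap.rTensor_tmul, forgetCoact,
          LinearMap.comp_apply]
        generalize W.coact w = s
        induction s using TensorProduct.induction_on with
        | zero => simp
        | add x y hx hy => simp only [map_add, TensorProduct.add_tmul, hx, hy]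
        | tmul y c => simp
    refine LinearMap.ext fun w => (key (W.coact w)).trans ?_
    rw [coassoc_apply, ← LinearMap.lTensor_comp_apply, forgetCoact, LinearMap.comp_apply,
      LinearMap.comp_apply, ← LinearMap.lTensor_comp_apply]
    congr 2
    exact LinearMap.ext map_forget_comul
  counit := by
    rw [← W.counit, forgetCoact, ← LinearMap.comp_assoc, ← LinearMap.lTensor_comp]
    congr 2
    exact LinearMap.ext counit_forget

end Corep

/-! ### Coherence of the sign twist -/

section SignTwist

variable {k : Type u} [Field k]
variable {U : Type*} [AddCommGroup U] [Module k U] {𝒰 : ZMod 2 → Submodule k U}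
variable {V : Type*} [AddCommGroup V] [Module k V] {𝒱 : ZMod 2 → Submodule k V}
variable {W : Type*} [AddCommGroup W] [Module k W] {𝒲 : ZMod 2 → Submodule k W}
variable [DirectSum.Decomposition 𝒰] [DirectSum.Decomposition 𝒱] [DirectSum.Decomposition 𝒲]

variable (𝒰 𝒱 𝒲) in
lemma tensor_ext_threefold {M : Type*} [AddCommGroup M] [Module k M]
    {f g : (U ⊗[k] V) ⊗[k] W →ₗ[k] M}
    (h : ∀ i j l, ∀ x ∈ 𝒰 i, ∀ y ∈ 𝒱 j, ∀ z ∈ 𝒲 l,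
      f ((x ⊗ₜ[k] y) ⊗ₜ[k] z) = g ((x ⊗ₜ[k] y) ⊗ₜ[k] z)) : f = g :=
  tensor_ext (tensorGrading 𝒰 𝒱) 𝒲 fun _ l _ ht z hz =>
    eqOn_tensor (f := f ∘ₗ (TensorProduct.mk k _ _).flip z)
      (g := g ∘ₗ (TensorProduct.mk k _ _).flip z)
      (fun i j _ x hx y hy => h i j l x hx y hy z hz) ht

/-- Both bracketings collect the exponent ij + il + jl, by biadditivity of the product of degrees.
-/
lemma assoc_signTwist {i j l : ZMod 2} {x : U} {y : V} {z : W} (hx : x ∈ 𝒰 i) (hy : y ∈ 𝒱 j)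
    (hz : z ∈ 𝒲 l) :
    TensorProduct.assoc k U V W (signTwist (tensorGrading 𝒰 𝒱) 𝒲 (signTwist 𝒰 𝒱 (x ⊗ₜ y) ⊗ₜ z)) =
      signTwist 𝒰 (tensorGrading 𝒱 𝒲) (x ⊗ₜ signTwist 𝒱 𝒲 (y ⊗ₜ z)) := by
  rw [signTwist_hom hx hy, signTwist_hom hy hz, ← TensorProduct.smul_tmul',
    TensorProduct.tmul_smul, map_smul, map_smul, map_smul,
    signTwist_hom (tmul_mem rfl hx hy) hz, signTwist_hom hx (tmul_mem rfl hy hz), map_smul,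
    TensorProduct.assoc_tmul, smul_smul, smul_smul, ← sgn_add, ← sgn_add]
  congr 2
  ring

lemma signTwist_unit_left (c : k) (x : W) :
    signTwist (unitGrading k) 𝒲 (c ⊗ₜ x) = c ⊗ₜ x := by
  have hc : c ∈ unitGrading k 0 := by simp [unitGrading]
  rw [← proj_add 𝒲 x, TensorProduct.tmul_add, map_add, signTwist_hom hc (proj_mem 𝒲 0 x),
    signTwist_hom hc (proj_mem 𝒲 1 x), zero_mul, zero_mul, sgn_zero, one_smul, one_smul]

lemma signTwist_unit_right (x : V) (c : k) :
    signTwist 𝒱 (unitGrading k) (x ⊗ₜ c) = x ⊗ₜ c := by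
  have hc : c ∈ unitGrading k 0 := by simp [unitGrading]
  rw [← proj_add 𝒱 x, TensorProduct.add_tmul, map_add, signTwist_hom (proj_mem 𝒱 0 x) hc,
    signTwist_hom (proj_mem 𝒱 1 x) hc, mul_zero, mul_zero, sgn_zero, one_smul, one_smul]

end SignTwist

/-! ### The functor, its essential inverse on objects, and its monoidal structure -/

namespace SuperCorep

variable {k : Type u} {H : Type v} [Field k] [Ring H] [Algebra k H] [Coalgebra k H]
variable (𝒜 : ZMod 2 → Submodule k H) [GradedAlgebra 𝒜] [HopfSuperalgebra 𝒜]

variable {𝒜} in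
/-- The comodule `(V, v ↦ v₀ ⊗ v₁ g^|v|)` over `k[ℤ/2] ⋉ H`. -/
noncomputable def bosonizeObj (V : SuperCorep 𝒜) : Corep k (Bosonization 𝒜) where
  carrier := V.carrier
  coact := bosonCoact 𝒜 V.grading V.coact
  coassoc := bosonCoact_coassoc V.coact_mem V.coassoc
  counit := bosonCoact_counit V.counit

/-- The functor `Corep(H) ⥤ Corep(k[ℤ/2] ⋉ H)`, `(V, ρ) ↦ (V, v ↦ v₀ ⊗ v₁ g^|v|)`. -/
noncomputable def bosonize : SuperCorep 𝒜 ⥤ Corep k (Bosonization 𝒜) where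
  obj := bosonizeObj
  map {V W} f := ⟨f.1, bosonCoact_naturality (V := V.carrier) (W := W.carrier) (𝒱 := V.grading)
    (𝒲 := W.grading) f.2.1 f.2.2⟩

variable {𝒜}

instance : (bosonize 𝒜).Additive where
  map_add := rfl

instance : (bosonize 𝒜).Linear k where
  map_smul _ _ := rfl

instance : (bosonize 𝒜).Faithful where
  map_injective {_ _ f g} h := hom_ext (show ((bosonize 𝒜).map f).1 = ((bosonize 𝒜).map g).1 by rw [h])

/-- The H'-coaction determines both the grading and the H-coaction, so a linear map compatible with
it is automatically even and compatible with the coactions of H. -/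
instance : (bosonize 𝒜).Full where
  map_surjective {V W} f := by
    let f' : V.carrier →ₗ[k] W.carrier := f.1
    have hf : f'.rTensor (Bosonization 𝒜) ∘ₗ bosonCoact 𝒜 V.grading V.coact =
        bosonCoact 𝒜 W.grading W.coact ∘ₗ f' := Corep.hom_comm f
    exact ⟨⟨f', fun _ _ hx => map_mem_of_comm_bosonCoact V.counit W.counit hf hx,
      comm_of_comm_bosonCoact hf⟩, rfl⟩

/-- Returning from `toSuperCorep` reproduces the original coaction on the same vector space, so the
identity map serves as the isomorphism. -/
instance : (bosonize 𝒜).EssSurj where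
  mem_essImage W := ⟨W.toSuperCorep, ⟨Corep.mkIso (V := bosonizeObj W.toSuperCorep)
    (LinearEquiv.refl k W.carrier)
    ((congrArg₂ LinearMap.comp (LinearMap.rTensor_id _ _) W.bosonCoact_forgetCoact).trans
      (LinearMap.id_comp W.coact))⟩⟩

instance : (bosonize 𝒜).IsEquivalence where

/-- The unit supercomodule is sent to the unit comodule. -/
noncomputable def bosonizeUnitIso : Corep.unit k (Bosonization 𝒜) ≅ bosonizeObj (unit 𝒜) :=
  Corep.mkIso (V := Corep.unit k (Bosonization 𝒜)) (W := bosonizeObj (unit 𝒜))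
    (LinearEquiv.refl k k) (by
    have h1 : (1 : k) ∈ unitGrading k 0 := by simp [unitGrading]
    refine LinearMap.ext_ring ?_
    -- The scalar 1 is even, so the power attached to it is g^0 and the coaction stays 1 ↦ 1 ⊗ 1.
    have h := bosonCoact_hom (𝒜 := 𝒜) (𝒱 := unitGrading k) ((TensorProduct.mk k k H).flip 1) h1
    rw [LinearMap.flip_apply, TensorProduct.mk_apply, LinearMap.lTensor_tmul, inclMul_apply,
      incl_one, genPow_zero, mul_one] at h
    exact h.symm)

/-- `v ⊗ w ↦ (-1)^(|v||w|) v ⊗ w` is compatible with the coactions of `k[ℤ/2] ⋉ H`. -/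
noncomputable def bosonizeTensorIso (V W : SuperCorep 𝒜) :
    Corep.tensor (bosonizeObj V) (bosonizeObj W) ≅ bosonizeObj (tensor V W) :=
  Corep.mkIso (V := Corep.tensor (bosonizeObj V) (bosonizeObj W)) (W := bosonizeObj (tensor V W))
    (signTwistEquiv (V := V.carrier) (W := W.carrier) V.grading W.grading)
    (signTwist_bosonCoact (V := V.carrier) (W := W.carrier) V.coact_mem W.coact_mem)

/-- The tensor structure of `bosonize`. -/
noncomputable def bosonizeCoreMonoidal : (bosonize 𝒜).CoreMonoidal where
  εIso := bosonizeUnitIso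
  μIso := bosonizeTensorIso
  μIso_hom_natural_left {V V'} f W := Corep.hom_ext <|
    tensor_ext V.grading W.grading fun i j x hx y hy => by
      change signTwist V'.grading W.grading (f.1 x ⊗ₜ y) =
        TensorProduct.map f.1 LinearMap.id (signTwist V.grading W.grading (x ⊗ₜ y))
      -- The morphism preserves degrees, so the same sign occurs before and after it.
      rw [signTwist_hom (f.2.1 i x hx) hy, signTwist_hom hx hy, map_smul]
      rfl
  μIso_hom_natural_right {V V'} W f := Corep.hom_ext <|
    tensor_ext W.grading V.grading fun i j x hx y hy => by
      change signTwist W.grading V'.grading (x ⊗ₜ f.1 y) =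
        TensorProduct.map LinearMap.id f.1 (signTwist W.grading V.grading (x ⊗ₜ y))
      rw [signTwist_hom hx (f.2.1 j y hy), signTwist_hom hx hy, map_smul]
      rfl
  associativity U V W := Corep.hom_ext <|
    tensor_ext_threefold U.grading V.grading W.grading fun i j l x hx y hy z hz => by
      change TensorProduct.assoc k U.carrier V.carrier W.carrier
          (signTwist (tensorGrading U.grading V.grading) W.grading
            (signTwist U.grading V.grading (x ⊗ₜ y) ⊗ₜ z)) =
        signTwist U.grading (tensorGrading V.grading W.grading)
          (x ⊗ₜ signTwist V.grading W.grading (y ⊗ₜ z))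
      exact assoc_signTwist hx hy hz
  left_unitality V := Corep.hom_ext <|
    tensor_ext (unitGrading k) V.grading fun i j c hc x hx => by
      change TensorProduct.lid k V.carrier (c ⊗ₜ x) =
        TensorProduct.lid k V.carrier (signTwist (unitGrading k) V.grading (c ⊗ₜ x))
      rw [signTwist_unit_left]
  right_unitality V := Corep.hom_ext <|
    tensor_ext V.grading (unitGrading k) fun i j x hx c hc => by
      change TensorProduct.rid k V.carrier (x ⊗ₜ c) =
        TensorProduct.rid k V.carrier (signTwist V.grading (unitGrading k) (x ⊗ₜ c))
      rw [signTwist_unit_right]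

end SuperCorep

end SuperHopf

theorem theorem6p1 {k : Type u} {H : Type v} [Field k] (hk : ringChar k ≠ 2)
    [Ring H] [Algebra k H] (𝒜 : ZMod 2 → Submodule k H) [GradedAlgebra 𝒜]
    [Coalgebra k H] [SuperHopf.HopfSuperalgebra 𝒜] :
    ∃ F : SuperHopf.SuperCorep 𝒜 ⥤ SuperHopf.Corep k (SuperHopf.Bosonization 𝒜),
      F.IsEquivalence ∧ F.Additive ∧ F.Linear k ∧ Nonempty F.Monoidal :=
  ⟨SuperHopf.SuperCorep.bosonize 𝒜, inferInstance, inferInstance, inferInstance,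
    ⟨SuperHopf.SuperCorep.bosonizeCoreMonoidal.toMonoidal⟩⟩
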